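/- Let $A\to M$ be a smooth real vector bundle of finite rank over a smooth manifold $M$ (finite-dimensional, Hausdorff, $\sigma$-compact, without boundary), and let $\mathcal F_A=\bigoplus_{k,l\ge 0}\mathcal F_A^{k,l}$ be the bigraded algebra of functions on $T^*\Pi A$ (polynomial in the momenta), with its canonical graded Poisson bracket $\{\cdot,\cdot\}$ (the big bracket). In local coordinates $x_i,p^i,\xi_j,\theta^j$ of bidegrees $(0,0),(1,1),(0,1),(1,0)$ one has $\{p^i,x_i\}=\{\theta^j,\xi_j\}=1$, all other brackets of coordinates being $0$. One has $C^\infty(M)=\mathcal F_A^{0,0}$, $\Gamma(\wedge^kA)=\mathcal F_A^{k,0}$, $\Gamma(\wedge^kA^*)=\mathcal F_A^{0,k}$, and $\mathrm{id}_A=\sum_j\xi_j\theta^j\in\mathcal F_A^{1,1}$. Let $\mu\in\mathcal F_A^{1,2}$, $\phi\in\Gamma(A^*)$, $\nu\in\mathcal F_A^{2,1}$, $X\in\Gamma(A)$. For $P,Q\in\Gamma(\wedge A)$ put $$[P,Q]_{\mu,\phi}=\{\{P,\mu+\mathrm{id}_A\,\phi\},Q\}-P\{\phi,Q\}+\{P,\phi\}Q,\qquad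 d_{\nu,X}Q=\{\nu,Q\}+XQ .$$ Suppose that $(\mu+\phi,\nu+X)$ is a Jacobi bialgebroid on $A$, i.e. that $\{\mu+\phi,\mu+\phi\}=0$, that $d_{\nu,X}\circ d_{\nu,X}=0$ on $\Gamma(\wedge A)$, and that $$d_{\nu,X}[a,b]_{\mu,\phi}=[d_{\nu,X}a,b]_{\mu,\phi}+(-1)^{k-1}[a,d_{\nu,X}b]_{\mu,\phi}\qquad\text{for all } k\ge 0,\ a\in\Gamma(\wedge^kA),\ b\in\Gamma(\wedge A).$$ Then: 1. the assignment $f\mapsto\{\{\mu,X\},f\}$, $C^\infty(M)\to C^\infty(M)$, is a smooth vector field $E$ on $M$, and $E[f]=-\{\{\nu,\phi\},f\}$ for all $f\in C^\infty(M)$; 2. the assignment $(f,g)\mapsto\{\{\mu,f\},\{\nu,g\}\}$, $C^\infty(M)\times C^\infty(M)\to C^\infty(M)$, is a smooth bivector field $\pi$ on $M$; 3. the pair $(\pi,E')$ with $E'=-E$ is a Jacobi structure on $M$, i.e. $[\pi,\pi]=-2\,E'\wedge\pi$ and $[E',\pi]=0$. Here $[\cdot,\cdot]$ is the Schouten bracket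 of multivector fields, with the sign convention for which $[\pi,\pi](f,g,h)=2\big(\pi(f,\pi(g,h))+\pi(g,\pi(h,f))+\pi(h,\pi(f,g))\big)$. -/

import Mathlib

open scoped Manifold ContDiff Polynomial

namespace BigBracket

section SuperCommutator
variable {B : Type*} [Ring B] [Algebra ℝ B]

/-- The even part of an element with respect to a parity involution `s`. -/
noncomputable def evenPart (s : B →ₐ[ℝ] B) (P : B) : B := (1 / 2 : ℝ) • (P + s P)
/-- The odd part of an element with respect to a parity involution `s`. -/
noncomputable def oddPart (s : B →ₐ[ℝ] B) (P : B) : B := (1 / 2 : ℝ) • (P - s P)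

/-- The supercommutator. With `P` split into its even and odd part, this is the bilinear extension
of `[P, Q] = P Q - (-1)^(|P| |Q|) Q P`. -/
noncomputable def superComm (s : B →ₐ[ℝ] B) (P Q : B) : B :=
  P * Q - Q * evenPart s P - s Q * oddPart s P

theorem superComm_add_left (s : B →ₐ[ℝ] B) (P P' Q : B) :
    superComm s (P + P') Q = superComm s P Q + superComm s P' Q := by
  simp only [superComm, evenPart, oddPart, map_add, mul_add, add_mul, mul_sub, mul_smul_comm]
  module

theorem superComm_add_right (s : B →ₐ[ℝ] B) (P Q Q' : B) :
    superComm s P (Q + Q') = superComm s P Q + superComm s P Q' := by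
  simp only [superComm, map_add, mul_add, add_mul]
  abel

theorem superComm_smul_left (s : B →ₐ[ℝ] B) (c : ℝ) (P Q : B) :
    superComm s (c • P) Q = c • superComm s P Q := by
  simp only [superComm, evenPart, oddPart, map_smul, mul_add, mul_sub, smul_mul_assoc,
    mul_smul_comm]
  module

theorem superComm_smul_right (s : B →ₐ[ℝ] B) (c : ℝ) (P Q : B) :
    superComm s P (c • Q) = c • superComm s P Q := by
  simp only [superComm, map_smul, smul_mul_assoc, mul_smul_comm, smul_sub]

theorem superComm_mul_left (s : B →ₐ[ℝ] B) (hs : ∀ b, s (s b) = b) (P Q R : B) :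
    superComm s (P * Q) R =
      P * superComm s Q R + superComm s P R * evenPart s Q + superComm s P (s R) * oddPart s Q := by
  simp only [superComm, evenPart, oddPart, map_mul, hs, mul_add, mul_sub, add_mul, sub_mul,
    smul_mul_assoc, mul_smul_comm, smul_add, smul_sub, mul_assoc]
  module

theorem superComm_jacobi (s : B →ₐ[ℝ] B) (hs : ∀ b, s (s b) = b) (P Q R : B) :
    superComm s (superComm s P Q) R =
      superComm s P (superComm s Q R) - superComm s Q (superComm s (evenPart s P) R)
        - superComm s (s Q) (superComm s (oddPart s P) R) := by
  simp only [superComm, evenPart, oddPart, map_mul, map_add, map_sub, map_smul, hs, mul_add,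
    mul_sub, add_mul, sub_mul, smul_mul_assoc, mul_smul_comm, smul_add, smul_sub, mul_assoc]
  module

theorem map_superComm (s : B →ₐ[ℝ] B) (hs : ∀ b, s (s b) = b) (P Q : B) :
    s (superComm s P Q) = superComm s (s P) (s Q) := by
  simp only [superComm, evenPart, oddPart, map_mul, map_add, map_sub, map_smul, hs]

end SuperCommutator

section SymbolAlgebra

/-- A real supercommutative algebra: an algebra with an involutive automorphism (multiplication by
the sign of the parity) for which all supercommutators vanish. -/
class SuperCommAlgebra (S : Type*) [Ring S] [Algebra ℝ S] where
  parity : S →ₐ[ℝ] S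
  parity_parity : ∀ a, parity (parity a) = a
  superComm_eq_zero : ∀ a b, superComm parity a b = 0

variable (S : Type*) [Ring S] [Algebra ℝ S] [SuperCommAlgebra S]

open SuperCommAlgebra Polynomial

/-- The induced parity involution on the linear operators of a superalgebra. -/
noncomputable def opParity : Module.End ℝ S →ₐ[ℝ] Module.End ℝ S :=
  AlgHom.ofLinearMap
    { toFun := fun P => (parity (S := S)).toLinearMap ∘ₗ P ∘ₗ (parity (S := S)).toLinearMap
      map_add' := fun P Q => by ext; simp
      map_smul' := fun c P => by ext; simp }
    (by ext; simp [parity_parity]) (fun P Q => by ext; simp [parity_parity])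

theorem opParity_apply (P : Module.End ℝ S) (a : S) :
    opParity S P a = parity (P (parity a)) := rfl

theorem opParity_opParity (P : Module.End ℝ S) : opParity S (opParity S P) = P := by
  ext a; simp [opParity_apply, parity_parity]

theorem opParity_mulLeft (r : S) :
    opParity S (LinearMap.mulLeft ℝ r) = LinearMap.mulLeft ℝ (parity r) := by
  ext a; simp [opParity_apply, parity_parity]

/-- `diffOp S n` is the space of linear superdifferential operators of order strictly less than `n`
on the supercommutative algebra `S`: the zero operator for `n = 0`, and, for `n + 1`, the operators
whose supercommutators with all multiplication operators have order strictly less than `n`. -/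
noncomputable def diffOp : ℕ → Submodule ℝ (Module.End ℝ S)
  | 0 => ⊥
  | n + 1 =>
    { carrier := {P | ∀ r : S, superComm (opParity S) P (LinearMap.mulLeft ℝ r) ∈ diffOp n}
      add_mem' := fun hP hQ r => by
        rw [superComm_add_left]; exact (diffOp n).add_mem (hP r) (hQ r)
      zero_mem' := fun r => by
        have := superComm_smul_left (opParity S) 0 0 (LinearMap.mulLeft ℝ r)
        rw [zero_smul, zero_smul] at this
        rw [this]; exact (diffOp n).zero_mem
      smul_mem' := fun c P hP r => by
        rw [superComm_smul_left]; exact (diffOp n).smul_mem c (hP r) }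

variable {S}

theorem mem_diffOp_succ {n : ℕ} {P : Module.End ℝ S} :
    P ∈ diffOp S (n + 1) ↔
      ∀ r : S, superComm (opParity S) P (LinearMap.mulLeft ℝ r) ∈ diffOp S n := Iff.rfl

theorem eq_zero_of_mem_diffOp_zero {P : Module.End ℝ S} (h : P ∈ diffOp S 0) : P = 0 := h

theorem superComm_zero_left {B : Type*} [Ring B] [Algebra ℝ B] (s : B →ₐ[ℝ] B) (Q : B) :
    superComm s 0 Q = 0 := by
  simp [superComm, evenPart, oddPart]

theorem superComm_zero_right {B : Type*} [Ring B] [Algebra ℝ B] (s : B →ₐ[ℝ] B) (P : B) :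
    superComm s P 0 = 0 := by
  simp [superComm]

theorem opParity_mem {n : ℕ} {P : Module.End ℝ S} (h : P ∈ diffOp S n) :
    opParity S P ∈ diffOp S n := by
  induction n generalizing P with
  | zero => rw [eq_zero_of_mem_diffOp_zero h, map_zero]; exact Submodule.zero_mem _
  | succ n ih =>
    intro r
    have := ih (h (parity r))
    rwa [map_superComm _ (opParity_opParity S), opParity_mulLeft, parity_parity] at this

theorem evenPart_mem {n : ℕ} {P : Module.End ℝ S} (h : P ∈ diffOp S n) :
    evenPart (opParity S) P ∈ diffOp S n :=
  Submodule.smul_mem _ _ (Submodule.add_mem _ h (opParity_mem h))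

theorem oddPart_mem {n : ℕ} {P : Module.End ℝ S} (h : P ∈ diffOp S n) :
    oddPart (opParity S) P ∈ diffOp S n :=
  Submodule.smul_mem _ _ (Submodule.sub_mem _ h (opParity_mem h))

theorem mul_mem_diffOp {i j : ℕ} {P Q : Module.End ℝ S} (hP : P ∈ diffOp S i)
    (hQ : Q ∈ diffOp S (j + 1)) : P * Q ∈ diffOp S (i + j) := by
  induction hn : i + j generalizing i j P Q with
  | zero =>
    obtain rfl : i = 0 := by omega
    rw [eq_zero_of_mem_diffOp_zero hP, zero_mul]; exact Submodule.zero_mem _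
  | succ n ih =>
    cases i with
    | zero => rw [eq_zero_of_mem_diffOp_zero hP, zero_mul]; exact Submodule.zero_mem _
    | succ i =>
      intro r
      rw [superComm_mul_left _ (opParity_opParity S), opParity_mulLeft]
      refine Submodule.add_mem _ (Submodule.add_mem _ ?_ ?_) ?_
      · cases j with
        | zero =>
          rw [eq_zero_of_mem_diffOp_zero (hQ r), mul_zero]; exact Submodule.zero_mem _
        | succ j => exact ih hP (hQ r) (by omega)
      · exact ih (hP r) (evenPart_mem hQ) (by omega)
      · exact ih (hP _) (oddPart_mem hQ) (by omega)

theorem mulLeft_mem (r : S) : LinearMap.mulLeft ℝ r ∈ diffOp S 1 := by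
  intro t
  have h : superComm (opParity S) (LinearMap.mulLeft ℝ r) (LinearMap.mulLeft ℝ t) =
      LinearMap.mulLeft ℝ (superComm parity r t) := by
    ext a
    simp [superComm, evenPart, oddPart, opParity_mulLeft, sub_mul, mul_assoc, add_mul,
      smul_add, smul_sub, mul_add, mul_sub]
  rw [h, superComm_eq_zero]
  have : LinearMap.mulLeft ℝ (0 : S) = 0 := by ext; simp
  rw [this]; exact Submodule.zero_mem _

theorem eq_mulLeft_of_mem {P : Module.End ℝ S} (h : P ∈ diffOp S 1) :
    P = LinearMap.mulLeft ℝ (P 1) := by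
  ext a
  have h1 := LinearMap.congr_fun (eq_zero_of_mem_diffOp_zero (h a)) 1
  have h2 := superComm_eq_zero (P 1) a
  simp only [superComm, evenPart, oddPart, opParity_mulLeft, LinearMap.sub_apply,
    Module.End.mul_apply, LinearMap.mulLeft_apply, LinearMap.smul_apply, LinearMap.add_apply,
    opParity_apply, map_one, mul_one, LinearMap.zero_apply] at h1 h2
  rw [LinearMap.mulLeft_apply]
  rw [sub_sub, sub_eq_zero] at h1 h2
  rw [h1, h2]

theorem diffOp_mono (n : ℕ) : diffOp S n ≤ diffOp S (n + 1) := by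
  induction n with
  | zero => exact bot_le
  | succ n ih => exact fun P hP r => ih (hP r)

theorem superComm_mem_diffOp {i j : ℕ} {P Q : Module.End ℝ S} (hP : P ∈ diffOp S (i + 1))
    (hQ : Q ∈ diffOp S (j + 1)) : superComm (opParity S) P Q ∈ diffOp S (i + j) := by
  induction hn : i + j generalizing i j P Q with
  | zero =>
    obtain rfl : i = 0 := by omega
    obtain rfl : j = 0 := by omega
    rw [eq_mulLeft_of_mem hQ]
    exact hP _
  | succ n ih =>
    have key : ∀ {i j : ℕ} {P Q : Module.End ℝ S}, P ∈ diffOp S (i + 1) → Q ∈ diffOp S (j + 1) →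
        i + j = n + 1 → ∀ r : S, superComm (opParity S) P
          (superComm (opParity S) Q (LinearMap.mulLeft ℝ r)) ∈ diffOp S n := by
      intro i j P Q hP hQ hn r
      cases j with
      | zero =>
        rw [eq_zero_of_mem_diffOp_zero (hQ r), superComm_zero_right]
        exact Submodule.zero_mem _
      | succ j => exact ih hP (hQ r) (by omega)
    intro r
    rw [superComm_jacobi _ (opParity_opParity S)]
    refine Submodule.sub_mem _ (Submodule.sub_mem _ (key hP hQ hn r) ?_) ?_
    · exact key hQ (evenPart_mem hP) (by omega) r
    · exact key (opParity_mem hQ) (oddPart_mem hP) (by omega) r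


end SymbolAlgebra

/-- An almost supercommutative filtered algebra; `order n` holds the elements of order strictly
less than `n`. The supercommutator lowers the sum of the orders by one. -/
structure AlmostSuperComm (B : Type*) [Ring B] [Algebra ℝ B] where
  parity : B →ₐ[ℝ] B
  order : ℕ → Submodule ℝ B
  order_zero : order 0 = ⊥
  one_mem : (1 : B) ∈ order 1
  mul_mem : ∀ {i j : ℕ} {P Q : B}, P ∈ order i → Q ∈ order (j + 1) → P * Q ∈ order (i + j)
  superComm_mem : ∀ {i j : ℕ} {P Q : B}, P ∈ order (i + 1) → Q ∈ order (j + 1) →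
    superComm parity P Q ∈ order (i + j)

namespace AlmostSuperComm

open Polynomial

variable {B : Type*} [Ring B] [Algebra ℝ B] (D : AlmostSuperComm B)

theorem eq_zero {P : B} (h : P ∈ D.order 0) : P = 0 := by
  rw [D.order_zero] at h; exact h

/-- The Rees algebra: polynomials whose coefficient of `X ^ k` has order at most `k`. -/
noncomputable def rees : Subalgebra ℝ B[X] where
  carrier := {p | ∀ k, p.coeff k ∈ D.order (k + 1)}
  add_mem' := fun hp hq k => by
    rw [coeff_add]; exact Submodule.add_mem _ (hp k) (hq k)
  mul_mem' := fun {p q} hp hq k => by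
    rw [coeff_mul]
    refine Submodule.sum_mem _ fun x hx => ?_
    have h := Finset.HasAntidiagonal.mem_antidiagonal.mp hx
    have := D.mul_mem (hp x.1) (hq x.2)
    rwa [show x.1 + 1 + x.2 = k + 1 by omega] at this
  algebraMap_mem' := fun c k => by
    rw [Polynomial.algebraMap_apply, coeff_C]
    split_ifs with hk
    · subst hk
      rw [Algebra.algebraMap_eq_smul_one]
      exact Submodule.smul_mem _ _ D.one_mem
    · exact Submodule.zero_mem _

/-- The polynomials whose coefficient of `X ^ k` has order at most `k - 1`. -/
noncomputable def lowerOrder : Ideal (D.rees) where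
  carrier := {p | ∀ k, (p : B[X]).coeff k ∈ D.order k}
  add_mem' := fun hp hq k => by
    rw [Subalgebra.coe_add, coeff_add]; exact Submodule.add_mem _ (hp k) (hq k)
  zero_mem' := fun k => by
    rw [Subalgebra.coe_zero, coeff_zero]; exact Submodule.zero_mem _
  smul_mem' := fun p q hq k => by
    rw [smul_eq_mul, Subalgebra.coe_mul, coeff_mul]
    refine Submodule.sum_mem _ fun x hx => ?_
    have h := Finset.HasAntidiagonal.mem_antidiagonal.mp hx
    have h2 := hq x.2
    cases hx2 : x.2 with
    | zero =>
      rw [hx2] at h2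
      rw [D.eq_zero h2, mul_zero]
      exact Submodule.zero_mem _
    | succ m =>
      rw [hx2] at h2
      have := D.mul_mem (p.2 x.1) h2
      rwa [show x.1 + 1 + m = k by omega] at this

instance : (D.lowerOrder).IsTwoSided where
  mul_mem_of_left {p} q hp := fun k => by
    rw [Subalgebra.coe_mul, coeff_mul]
    refine Submodule.sum_mem _ fun x hx => ?_
    have h := Finset.HasAntidiagonal.mem_antidiagonal.mp hx
    have := D.mul_mem (hp x.1) (q.2 x.2)
    rwa [h] at this

/-- The associated graded algebra, the direct sum over `k` of (order at most `k`) modulo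
(order at most `k - 1`), written as a quotient of the Rees algebra. -/
def Gr : Type _ := D.rees ⧸ D.lowerOrder

noncomputable instance : Ring (D.Gr) := inferInstanceAs (Ring (D.rees ⧸ D.lowerOrder))
noncomputable instance : Algebra ℝ (D.Gr) :=
  inferInstanceAs (Algebra ℝ (D.rees ⧸ D.lowerOrder))


/-- Parity, coefficient by coefficient. -/
noncomputable def polyParity : B[X] →ₐ[ℝ] B[X] :=
  mapAlgHom (D.parity)

theorem coeff_superComm (p q : B[X]) (n : ℕ) :
    (superComm D.polyParity p q).coeff n =
      ∑ x ∈ Finset.HasAntidiagonal.antidiagonal n, superComm (D.parity) (p.coeff x.1) (q.coeff x.2) := by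
  have hs : ∀ p : B[X], ∀ i,
      (D.polyParity p).coeff i = D.parity (p.coeff i) := fun p i => by
    simp [polyParity, mapAlgHom, coeff_map]
  have he : ∀ i, (evenPart D.polyParity p).coeff i = evenPart (D.parity) (p.coeff i) := fun i => by
    simp [evenPart, hs]
  have ho : ∀ i, (oddPart D.polyParity p).coeff i = oddPart (D.parity) (p.coeff i) := fun i => by
    simp [oddPart, hs]
  simp only [superComm, coeff_sub, coeff_mul, Finset.sum_sub_distrib, hs, he, ho]
  congr 1
  · congr 1
    rw [← Finset.Nat.sum_antidiagonal_swap]; rfl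
  · rw [← Finset.Nat.sum_antidiagonal_swap]; rfl

/-- Divide the supercommutator in the Rees algebra by `X`. -/
noncomputable def reesBracket (p q : D.rees) : D.rees :=
  ⟨divX (superComm D.polyParity (p : B[X]) q), fun k => by
    rw [coeff_divX, coeff_superComm]
    refine Submodule.sum_mem _ fun x hx => ?_
    have h := Finset.HasAntidiagonal.mem_antidiagonal.mp hx
    have := D.superComm_mem (p.2 x.1) (q.2 x.2)
    rwa [h] at this⟩

theorem reesBracket_mem_left {p q : D.rees} (hp : p ∈ D.lowerOrder) :
    D.reesBracket p q ∈ D.lowerOrder := fun k => by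
  change (divX _).coeff k ∈ _
  rw [coeff_divX, coeff_superComm]
  refine Submodule.sum_mem _ fun x hx => ?_
  have h := Finset.HasAntidiagonal.mem_antidiagonal.mp hx
  have h1 := hp x.1
  cases hx1 : x.1 with
  | zero =>
    rw [hx1] at h1
    rw [D.eq_zero h1, superComm_zero_left]; exact Submodule.zero_mem _
  | succ m =>
    rw [hx1] at h1
    have := D.superComm_mem h1 (q.2 x.2)
    rwa [show m + x.2 = k by omega] at this

theorem reesBracket_mem_right {p q : D.rees} (hq : q ∈ D.lowerOrder) :
    D.reesBracket p q ∈ D.lowerOrder := fun k => by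
  change (divX _).coeff k ∈ _
  rw [coeff_divX, coeff_superComm]
  refine Submodule.sum_mem _ fun x hx => ?_
  have h := Finset.HasAntidiagonal.mem_antidiagonal.mp hx
  have h1 := hq x.2
  cases hx1 : x.2 with
  | zero =>
    rw [hx1] at h1
    rw [D.eq_zero h1, superComm_zero_right]; exact Submodule.zero_mem _
  | succ m =>
    rw [hx1] at h1
    have := D.superComm_mem (p.2 x.1) h1
    rwa [show x.1 + m = k by omega] at this

theorem reesBracket_add_left (p p' q : D.rees) :
    D.reesBracket (p + p') q = D.reesBracket p q + D.reesBracket p' q :=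
  Subtype.ext (by simp [reesBracket, superComm_add_left, divX_add])

theorem reesBracket_add_right (p q q' : D.rees) :
    D.reesBracket p (q + q') = D.reesBracket p q + D.reesBracket p q' :=
  Subtype.ext (by simp [reesBracket, superComm_add_right, divX_add])

theorem reesBracket_smul_left (c : ℝ) (p q : D.rees) :
    D.reesBracket (c • p) q = c • D.reesBracket p q :=
  Subtype.ext (by ext; simp [reesBracket, superComm_smul_left, coeff_divX])

theorem reesBracket_smul_right (c : ℝ) (p q : D.rees) :
    D.reesBracket p (c • q) = c • D.reesBracket p q :=
  Subtype.ext (by ext; simp [reesBracket, superComm_smul_right, coeff_divX])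

/-- The quotient map. -/
noncomputable def toGr : D.rees →ₐ[ℝ] D.Gr := Ideal.Quotient.mkₐ ℝ D.lowerOrder

theorem toGr_surjective : Function.Surjective D.toGr := Ideal.Quotient.mk_surjective

theorem toGr_eq_toGr {p q : D.rees} : D.toGr p = D.toGr q ↔ p - q ∈ D.lowerOrder :=
  Ideal.Quotient.eq

/-- The graded Poisson bracket of symbols, on elements. -/
noncomputable def bracketFun (F G : D.Gr) : D.Gr :=
  Quotient.map₂ D.reesBracket (by
    intro p p' hp q q' hq
    have hp' : p - p' ∈ D.lowerOrder := (Submodule.quotientRel_def _).mp hp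
    have hq' : q - q' ∈ D.lowerOrder := (Submodule.quotientRel_def _).mp hq
    refine (Submodule.quotientRel_def D.lowerOrder).mpr ?_
    have h1 := D.reesBracket_add_left (p - p') p' q
    have h2 := D.reesBracket_add_right p' (q - q') q'
    rw [sub_add_cancel] at h1 h2
    rw [h1, h2, add_sub_assoc, add_sub_cancel_right]
    exact Ideal.add_mem _ (D.reesBracket_mem_left hp') (D.reesBracket_mem_right hq')) F G

theorem bracketFun_toGr (p q : D.rees) :
    D.bracketFun (D.toGr p) (D.toGr q) = D.toGr (D.reesBracket p q) := rfl

/-- The graded Poisson bracket of symbols: the bracket of the symbols of `P` (order `i`) and `Q`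
(order `j`) is the symbol of order `i + j - 1` of the supercommutator of `P` and `Q`. -/
noncomputable def bracket : D.Gr →ₗ[ℝ] D.Gr →ₗ[ℝ] D.Gr :=
  LinearMap.mk₂ ℝ D.bracketFun
    (fun F F' G => by
      obtain ⟨p, rfl⟩ := D.toGr_surjective F
      obtain ⟨p', rfl⟩ := D.toGr_surjective F'
      obtain ⟨q, rfl⟩ := D.toGr_surjective G
      rw [← map_add, bracketFun_toGr, reesBracket_add_left, map_add]; rfl)
    (fun c F G => by
      obtain ⟨p, rfl⟩ := D.toGr_surjective F
      obtain ⟨q, rfl⟩ := D.toGr_surjective G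
      rw [← map_smul, bracketFun_toGr, reesBracket_smul_left, map_smul]; rfl)
    (fun F G G' => by
      obtain ⟨p, rfl⟩ := D.toGr_surjective F
      obtain ⟨q, rfl⟩ := D.toGr_surjective G
      obtain ⟨q', rfl⟩ := D.toGr_surjective G'
      rw [← map_add, bracketFun_toGr, reesBracket_add_right, map_add]; rfl)
    (fun c F G => by
      obtain ⟨p, rfl⟩ := D.toGr_surjective F
      obtain ⟨q, rfl⟩ := D.toGr_surjective G
      rw [← map_smul, bracketFun_toGr, reesBracket_smul_right, map_smul]; rfl)

theorem monomial_mem (k : ℕ) {P : B} (h : P ∈ D.order (k + 1)) : monomial k P ∈ D.rees :=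
  fun i => by
    rw [coeff_monomial]
    split_ifs with hi
    · subst hi; exact h
    · exact Submodule.zero_mem _

/-- The principal symbol of order `k` of an element of order at most `k`. -/
noncomputable def symbol (k : ℕ) (P : B) (h : P ∈ D.order (k + 1)) : D.Gr :=
  D.toGr ⟨monomial k P, D.monomial_mem k h⟩

end AlmostSuperComm

section SuperOperators

open SuperCommAlgebra

variable (S : Type*) [Ring S] [Algebra ℝ S] [SuperCommAlgebra S]

/-- The operators on a supercommutative algebra, filtered by the order of superdifferential
operators. -/
noncomputable def diffOpFiltration : AlmostSuperComm (Module.End ℝ S) where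
  parity := opParity S
  order := diffOp S
  order_zero := rfl
  one_mem := by
    have := mulLeft_mem (1 : S)
    rwa [LinearMap.mulLeft_one] at this
  mul_mem := mul_mem_diffOp
  superComm_mem := superComm_mem_diffOp

theorem derivation_mem {S : Type*} [Ring S] [Algebra ℝ S] [SuperCommAlgebra S]
    {P : Module.End ℝ S}
    (h : ∀ r, ∃ t, superComm (opParity S) P (LinearMap.mulLeft ℝ r) = LinearMap.mulLeft ℝ t) :
    P ∈ diffOp S 2 := fun r => by
  obtain ⟨t, ht⟩ := h r
  rw [ht]; exact mulLeft_mem t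

end SuperOperators


section Exterior

variable {C N : Type*} [CommRing C] [Algebra ℝ C] [AddCommGroup N] [Module C N] [Module ℝ N]
  [IsScalarTower ℝ C N]

/-- The parity involution of an exterior algebra. -/
noncomputable def extParity : ExteriorAlgebra C N →ₐ[ℝ] ExteriorAlgebra C N :=
  (CliffordAlgebra.involute (Q := (0 : QuadraticForm C N))).restrictScalars ℝ

theorem extParity_ι (v : N) :
    extParity (ExteriorAlgebra.ι C v) = -ExteriorAlgebra.ι C v :=
  CliffordAlgebra.involute_ι v

theorem extParity_algebraMap (c : C) :
    extParity (algebraMap C (ExteriorAlgebra C N) c) = algebraMap C _ c :=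
  AlgHom.commutes _ c

theorem extParity_extParity (a : ExteriorAlgebra C N) : extParity (extParity a) = a :=
  CliffordAlgebra.involute_involute a

theorem evenPart_of_odd {B : Type*} [Ring B] [Algebra ℝ B] {s : B →ₐ[ℝ] B} {P : B}
    (h : s P = -P) : evenPart s P = 0 := by
  simp [evenPart, h]

theorem oddPart_of_odd {B : Type*} [Ring B] [Algebra ℝ B] {s : B →ₐ[ℝ] B} {P : B}
    (h : s P = -P) : oddPart s P = P := by
  rw [oddPart, h]; module

theorem evenPart_of_even {B : Type*} [Ring B] [Algebra ℝ B] {s : B →ₐ[ℝ] B} {P : B}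
    (h : s P = P) : evenPart s P = P := by
  rw [evenPart, h]; module

theorem oddPart_of_even {B : Type*} [Ring B] [Algebra ℝ B] {s : B →ₐ[ℝ] B} {P : B}
    (h : s P = P) : oddPart s P = 0 := by
  simp [oddPart, h]

theorem ι_mul_ext (v : N) (b : ExteriorAlgebra C N) :
    ExteriorAlgebra.ι C v * b = extParity b * ExteriorAlgebra.ι C v := by
  induction b using ExteriorAlgebra.induction with
  | algebraMap r => rw [extParity_algebraMap, Algebra.commutes]
  | ι w =>
    have := ExteriorAlgebra.ι_add_mul_swap (R := C) v w
    rw [extParity_ι, neg_mul]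
    exact eq_neg_of_add_eq_zero_left this
  | mul a b ha hb => rw [map_mul, ← mul_assoc, ha, mul_assoc, hb, mul_assoc]
  | add a b ha hb => rw [map_add, mul_add, add_mul, ha, hb]

theorem superComm_ext (a b : ExteriorAlgebra C N) : superComm extParity a b = 0 := by
  induction a using ExteriorAlgebra.induction generalizing b with
  | algebraMap r =>
    rw [superComm, evenPart_of_even (extParity_algebraMap r),
      oddPart_of_even (extParity_algebraMap r), mul_zero, sub_zero, Algebra.commutes, sub_self]
  | ι w =>
    rw [superComm, evenPart_of_odd (extParity_ι w), oddPart_of_odd (extParity_ι w), mul_zero,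
      sub_zero, ι_mul_ext, sub_self]
  | mul a b ha hb =>
    rw [superComm_mul_left _ extParity_extParity, ha, ha, hb]; simp
  | add a b ha hb => rw [superComm_add_left, ha, hb, add_zero]

noncomputable instance : SuperCommAlgebra (ExteriorAlgebra C N) where
  parity := extParity
  parity_parity := extParity_extParity
  superComm_eq_zero := superComm_ext

theorem extParity_of_mem {i : ℕ} {a : ExteriorAlgebra C N} (h : a ∈ ⋀[C]^i N) :
    extParity a = (-1 : ℝ) ^ i • a := by
  induction h using Submodule.pow_induction_on_left' with
  | algebraMap r => rw [extParity_algebraMap, pow_zero, one_smul]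
  | add x y i hx hy ihx ihy => rw [map_add, ihx, ihy, smul_add]
  | mem_mul m hm i x hx ih =>
    obtain ⟨v, rfl⟩ := hm
    rw [map_mul, ih, extParity_ι, pow_succ]; simp

/-- Contraction of forms with an element `d` of the dual module, an odd derivation. -/
noncomputable def contraction (d : Module.Dual C N) : Module.End ℝ (ExteriorAlgebra C N) :=
  (CliffordAlgebra.contractLeft (Q := (0 : QuadraticForm C N)) d).restrictScalars ℝ

theorem contraction_mul (d : Module.Dual C N) (a b : ExteriorAlgebra C N) :
    contraction d (a * b) = contraction d a * b + extParity a * contraction d b := by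
  induction a using ExteriorAlgebra.induction generalizing b with
  | algebraMap r =>
    rw [extParity_algebraMap]
    have h1 := CliffordAlgebra.contractLeft_algebraMap_mul (Q := (0 : QuadraticForm C N)) d r b
    have h2 := CliffordAlgebra.contractLeft_algebraMap (Q := (0 : QuadraticForm C N)) d r
    simp only [contraction, LinearMap.restrictScalars_apply]
    erw [h1, h2]; simp
  | ι w =>
    rw [extParity_ι]
    have h1 := CliffordAlgebra.contractLeft_ι_mul (Q := (0 : QuadraticForm C N)) d w b
    have h2 := CliffordAlgebra.contractLeft_ι (Q := (0 : QuadraticForm C N)) d w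
    simp only [contraction, LinearMap.restrictScalars_apply]
    erw [h1, h2, Algebra.smul_def]
    rw [neg_mul, sub_eq_add_neg]
  | mul x y hx hy =>
    rw [mul_assoc, hx, hy, hx, map_mul]; noncomm_ring
  | add x y hx hy => rw [add_mul, map_add, hx, hy, map_add, map_add]; noncomm_ring

theorem contraction_extParity (d : Module.Dual C N) (a : ExteriorAlgebra C N) :
    contraction d (extParity a) = -extParity (contraction d a) := by
  induction a using ExteriorAlgebra.induction with
  | algebraMap r =>
    rw [extParity_algebraMap]
    have h2 := CliffordAlgebra.contractLeft_algebraMap (Q := (0 : QuadraticForm C N)) d r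
    simp only [contraction, LinearMap.restrictScalars_apply]
    erw [h2]; simp
  | ι w =>
    have h2 : contraction d (ExteriorAlgebra.ι C w) = algebraMap C _ (d w) :=
      CliffordAlgebra.contractLeft_ι (Q := (0 : QuadraticForm C N)) d w
    rw [extParity_ι, map_neg, h2, extParity_algebraMap]
  | mul x y hx hy =>
    rw [map_mul, contraction_mul, contraction_mul, map_add, map_mul, map_mul, hx, hy]
    noncomm_ring
  | add x y hx hy => rw [map_add, map_add, hx, hy, map_add, map_add, neg_add]

theorem contraction_mem (d : Module.Dual C N) :
    contraction d ∈ diffOp (ExteriorAlgebra C N) 2 := by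
  refine derivation_mem fun r => ⟨contraction d r, ?_⟩
  have hodd : opParity (ExteriorAlgebra C N) (contraction d) = -contraction d := by
    ext a
    change extParity (contraction d (extParity a)) = _
    rw [contraction_extParity, map_neg, extParity_extParity]; rfl
  rw [superComm, evenPart_of_odd hodd, oddPart_of_odd hodd, opParity_mulLeft]
  ext a
  rw [mul_zero]
  change contraction d (r * a) - 0 - extParity r * contraction d a = contraction d r * a
  rw [contraction_mul]; abel

variable (C N) in
/-- The Euler derivation, multiplication by `i` on forms of degree `i`. For a local frame `ξ j` of
`N` with dual frame `θ j` it is the sum of the `ξ j * contraction (θ j)`. -/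
noncomputable def euler : Module.End ℝ (ExteriorAlgebra C N) :=
  ((DirectSum.toModule C ℕ (ExteriorAlgebra C N) fun i => (i : C) • (⋀[C]^i N).subtype) ∘ₗ
    (DirectSum.decomposeLinearEquiv (fun i : ℕ => ⋀[C]^i N)).toLinearMap).restrictScalars ℝ

theorem euler_of_mem {i : ℕ} {a : ExteriorAlgebra C N} (h : a ∈ ⋀[C]^i N) :
    euler C N a = (i : ℝ) • a := by
  have : euler C N a = (i : C) • a := by
    simp only [euler, LinearMap.restrictScalars_apply, LinearMap.comp_apply,
      LinearEquiv.coe_coe, DirectSum.decomposeLinearEquiv_apply]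
    lift a to ⋀[C]^i N using h
    rw [DirectSum.decompose_coe, ← DirectSum.lof_eq_of C, DirectSum.toModule_lof]
    rfl
  rw [this]
  simp only [Nat.cast_smul_eq_nsmul]

theorem euler_mul (a b : ExteriorAlgebra C N) :
    euler C N (a * b) = euler C N a * b + a * euler C N b := by
  induction a using DirectSum.Decomposition.inductionOn fun i => ⋀[C]^i N with
  | zero => simp
  | add x y hx hy => rw [add_mul, map_add, hx, hy, map_add]; noncomm_ring
  | @homogeneous i x =>
    induction b using DirectSum.Decomposition.inductionOn fun i => ⋀[C]^i N with
    | zero => simp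
    | add x y hx hy => rw [mul_add, map_add, hx, hy, map_add]; noncomm_ring
    | @homogeneous j y =>
      have hxy : (x : ExteriorAlgebra C N) * y ∈ ⋀[C]^(i + j) N :=
        SetLike.GradedMul.mul_mem x.2 y.2
      rw [euler_of_mem hxy, euler_of_mem x.2, euler_of_mem y.2]
      push_cast
      rw [add_smul, smul_mul_assoc, mul_smul_comm]

theorem euler_mem : euler C N ∈ diffOp (ExteriorAlgebra C N) 2 := by
  refine derivation_mem fun r => ⟨euler C N r, ?_⟩
  have heven : opParity (ExteriorAlgebra C N) (euler C N) = euler C N := by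
    ext a
    change extParity (euler C N (extParity a)) = _
    induction a using DirectSum.Decomposition.inductionOn fun i => ⋀[C]^i N with
    | zero => simp
    | add x y hx hy => simp only [map_add, hx, hy]
    | @homogeneous i x =>
      rw [extParity_of_mem x.2, map_smul, euler_of_mem x.2, map_smul, map_smul,
        extParity_of_mem x.2, smul_comm (i : ℝ), smul_smul, ← mul_pow]
      simp
  rw [superComm, evenPart_of_even heven, oddPart_of_even heven, mul_zero, sub_zero]
  ext a
  change euler C N (r * a) - r * euler C N a = euler C N r * a
  rw [euler_mul]; abel

/-- The operator `P` maps forms of degree `i` to forms of degree `i + m`. -/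
def HasWeight (m : ℤ) (P : Module.End ℝ (ExteriorAlgebra C N)) : Prop :=
  ∀ (i : ℕ) (w : ExteriorAlgebra C N), w ∈ ⋀[C]^i N →
    (∀ j : ℕ, (j : ℤ) = i + m → P w ∈ ⋀[C]^j N) ∧ ((i : ℤ) + m < 0 → P w = 0)

end Exterior

section BigBracketAbstract

variable (C N : Type*) [CommRing C] [Algebra ℝ C] [AddCommGroup N] [Module C N] [Module ℝ N]
  [IsScalarTower ℝ C N]

/-- For the module `N` of sections of a dual bundle `A*` over the algebra `C` of smooth functions,
the exterior algebra of `N` is the algebra of functions on the supermanifold `ΠA`, and this is the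
algebra of functions on `T*ΠA` that are polynomial on the fibres of the cotangent bundle, obtained
as the algebra of principal symbols of superdifferential operators on `ΠA`. In local coordinates
`x`, `ξ` on `ΠA`, the momenta `p` and `θ` are the symbols of `∂/∂x` and `∂/∂ξ`. -/
abbrev SuperFunctions : Type _ := (diffOpFiltration (ExteriorAlgebra C N)).Gr

variable {C N}

/-- The big bracket, the canonical Poisson bracket of `T*ΠA`: `{p, x} = 1`, `{θ, ξ} = 1`. -/
noncomputable def bb (F G : SuperFunctions C N) : SuperFunctions C N :=
  (diffOpFiltration (ExteriorAlgebra C N)).bracket F G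

/-- Forms (functions on `ΠA`) as functions on `T*ΠA`. -/
noncomputable def ofForm (w : ExteriorAlgebra C N) : SuperFunctions C N :=
  (diffOpFiltration (ExteriorAlgebra C N)).symbol 0 (LinearMap.mulLeft ℝ w) (mulLeft_mem w)

/-- Functions on the base as functions on `T*ΠA`. -/
noncomputable def ofFun (f : C) : SuperFunctions C N := ofForm (algebraMap C _ f)

/-- Sections of `A*` as functions on `T*ΠA`. -/
noncomputable def ofCovector (ξ : N) : SuperFunctions C N := ofForm (ExteriorAlgebra.ι C ξ)

/-- Elements of the dual of `N` (sections of `A`) as functions on `T*ΠA`: symbols of contractions. -/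
noncomputable def ofVector (d : Module.Dual C N) : SuperFunctions C N :=
  (diffOpFiltration (ExteriorAlgebra C N)).symbol 1 (contraction d) (contraction_mem d)

variable (C N) in
/-- The function `id_A`, locally the sum of the `ξ j * θ j`. -/
noncomputable def idFun : SuperFunctions C N :=
  (diffOpFiltration (ExteriorAlgebra C N)).symbol 1 (euler C N) euler_mem

variable (C N) in
/-- The functions of bidegree `(k, l)`: symbols of order `k` of operators that raise the degree of
forms by `l - k`. The coordinates `x`, `p`, `ξ`, `θ` have bidegrees `(0,0)`, `(1,1)`, `(0,1)`,
`(1,0)`. -/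
def bidegree (k l : ℕ) : Set (SuperFunctions C N) :=
  {x | ∃ (P : Module.End ℝ (ExteriorAlgebra C N))
      (h : P ∈ diffOp (ExteriorAlgebra C N) (k + 1)),
    HasWeight ((l : ℤ) - k) P ∧ (diffOpFiltration (ExteriorAlgebra C N)).symbol k P h = x}

end BigBracketAbstract

section Geometry

variable {E : Type*} [NormedAddCommGroup E] [NormedSpace ℝ E] {M : Type*} [TopologicalSpace M]
  [ChartedSpace E M] {F : Type*} [NormedAddCommGroup F] [NormedSpace ℝ F] {V : M → Type*}
  [TopologicalSpace (Bundle.TotalSpace F V)] [∀ x, AddCommGroup (V x)] [∀ x, Module ℝ (V x)]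
  [∀ x, TopologicalSpace (V x)] [FiberBundle F V] [VectorBundle ℝ F V]

/-- Smooth sections form a module over the smooth functions. -/
noncomputable instance sectionModule : Module C^∞⟮𝓘(ℝ, E), M; ℝ⟯ Cₛ^∞⟮𝓘(ℝ, E); F, V⟯ where
  smul f s := ⟨fun x => f x • s x, ContMDiff.smul_section f.contMDiff s.contMDiff⟩
  one_smul s := by ext x; exact one_smul ℝ (s x)
  mul_smul f g s := by ext x; exact mul_smul (f x) (g x) (s x)
  smul_zero f := by ext x; exact smul_zero (f x)
  smul_add f s t := by ext x; exact smul_add (f x) (s x) (t x)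
  add_smul f g s := by ext x; exact add_smul (f x) (g x) (s x)
  zero_smul s := by ext x; exact zero_smul ℝ (s x)

instance sectionTower :
    IsScalarTower ℝ C^∞⟮𝓘(ℝ, E), M; ℝ⟯ Cₛ^∞⟮𝓘(ℝ, E); F, V⟯ where
  smul_assoc c f s := by ext x; exact mul_smul c (f x) (s x)

variable [∀ x, IsTopologicalAddGroup (V x)] [∀ x, ContinuousSMul ℝ (V x)]
  [ContMDiffVectorBundle ∞ F V 𝓘(ℝ, E)]

variable (E F V) in
/-- Smooth sections of the dual bundle. -/
abbrev DualSection : Type _ := Cₛ^∞⟮𝓘(ℝ, E); F →L[ℝ] ℝ, fun x => V x →L[ℝ] ℝ⟯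

/-- The pairing of a section of `A` with the sections of `A*`. -/
noncomputable def pairing (a : Cₛ^∞⟮𝓘(ℝ, E); F, V⟯) :
    Module.Dual C^∞⟮𝓘(ℝ, E), M; ℝ⟯ (DualSection E F V) where
  toFun ξ := ⟨fun x => ξ x (a x), fun x => by
    have h := ContMDiffAt.clm_bundle_apply (F₂ := ℝ) (E₂ := Bundle.Trivial M ℝ)
      (ξ.contMDiff x) (a.contMDiff x)
    exact (Bundle.contMDiffAt_section x).mp h⟩
  map_add' ξ η := by ext x; rfl
  map_smul' f ξ := by ext x; rfl


variable (E F V) in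
/-- The algebra of functions on `T*ΠA` for the vector bundle `A` with fibres `V x`, with the big
bracket `bb`. -/
abbrev FunctionAlgebra : Type _ := SuperFunctions C^∞⟮𝓘(ℝ, E), M; ℝ⟯ (DualSection E F V)

/-- A section of `A` as a function on `T*ΠA`. -/
noncomputable def ofSection (a : Cₛ^∞⟮𝓘(ℝ, E); F, V⟯) : FunctionAlgebra E F V :=
  ofVector (pairing a)

variable (E F V) in
/-- The sections of the `k`-th exterior power of `A`, inside the algebra of functions on `T*ΠA`:
the span of the products `f a₁ ⋯ aₖ`. -/
noncomputable def multisection (k : ℕ) : Submodule ℝ (FunctionAlgebra E F V) :=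
  Submodule.span ℝ {P | ∃ (f : C^∞⟮𝓘(ℝ, E), M; ℝ⟯) (a : Fin k → Cₛ^∞⟮𝓘(ℝ, E); F, V⟯),
    P = ofFun f * (List.ofFn fun i => ofSection (a i)).prod}

/-- The bracket of the pre-Jacobi algebroid `μ + φ` on `A`. -/
noncomputable def jacobiBracket (μ : FunctionAlgebra E F V) (φ : DualSection E F V)
    (P Q : FunctionAlgebra E F V) : FunctionAlgebra E F V :=
  bb (bb P (μ + idFun _ _ * ofCovector φ)) Q - P * bb (ofCovector φ) Q + bb P (ofCovector φ) * Q

/-- The differential of the pre-Jacobi algebroid `ν + X` on `A*`, on multisections of `A`. -/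
noncomputable def jacobiDifferential (ν : FunctionAlgebra E F V) (X : Cₛ^∞⟮𝓘(ℝ, E); F, V⟯)
    (Q : FunctionAlgebra E F V) : FunctionAlgebra E F V :=
  bb ν Q + ofSection X * Q

/-- `(μ + φ, ν + X)` is a Jacobi bialgebroid on `A`. A pre-Jacobi algebroid on `A*` is seen as an
element `ν + X` of the function algebra of `A`, with `ν` of bidegree `(2, 1)`. -/
structure IsJacobiBialgebroid (μ : FunctionAlgebra E F V) (φ : DualSection E F V)
    (ν : FunctionAlgebra E F V) (X : Cₛ^∞⟮𝓘(ℝ, E); F, V⟯) : Prop where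
  bidegree_left : μ ∈ bidegree C^∞⟮𝓘(ℝ, E), M; ℝ⟯ (DualSection E F V) 1 2
  bidegree_right : ν ∈ bidegree C^∞⟮𝓘(ℝ, E), M; ℝ⟯ (DualSection E F V) 2 1
  compatible : ∀ (k : ℕ), ∀ a ∈ multisection E F V k, ∀ b ∈ ⨆ l, multisection E F V l,
    jacobiDifferential ν X (jacobiBracket μ φ a b) =
      jacobiBracket μ φ (jacobiDifferential ν X a) b +
        (-1 : ℝ) ^ (k + 1) • jacobiBracket μ φ a (jacobiDifferential ν X b)
  jacobi_left : bb (μ + ofCovector φ) (μ + ofCovector φ) = 0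
  differential_sq : ∀ b ∈ ⨆ l, multisection E F V l,
    jacobiDifferential ν X (jacobiDifferential ν X b) = 0

end Geometry

section JacobiManifold

variable {E : Type*} [NormedAddCommGroup E] [NormedSpace ℝ E] {M : Type*} [TopologicalSpace M]
  [ChartedSpace E M] [IsManifold 𝓘(ℝ, E) ∞ M]

/-- The assignment `Z` on smooth functions is (the action of) a smooth vector field. -/
def IsVectorField (Z : C^∞⟮𝓘(ℝ, E), M; ℝ⟯ → C^∞⟮𝓘(ℝ, E), M; ℝ⟯) : Prop :=
  ∃ v : Cₛ^∞⟮𝓘(ℝ, E); E, fun x : M => TangentSpace 𝓘(ℝ, E) x⟯,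
    ∀ (f : C^∞⟮𝓘(ℝ, E), M; ℝ⟯) (x : M), Z f x = mfderiv 𝓘(ℝ, E) 𝓘(ℝ, ℝ) f x (v x)

/-- The assignment `P` on pairs of smooth functions is (the action of) a smooth bivector field,
given here by the skew bundle map `s` from the cotangent to the tangent bundle:
`P f g = ⟨dg, s (df)⟩`. -/
def IsBivectorField
    (P : C^∞⟮𝓘(ℝ, E), M; ℝ⟯ → C^∞⟮𝓘(ℝ, E), M; ℝ⟯ → C^∞⟮𝓘(ℝ, E), M; ℝ⟯) : Prop :=
  ∃ s : Cₛ^∞⟮𝓘(ℝ, E); (E →L[ℝ] ℝ) →L[ℝ] E,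
      fun x : M => (TangentSpace 𝓘(ℝ, E) x →L[ℝ] ℝ) →L[ℝ] TangentSpace 𝓘(ℝ, E) x⟯,
    (∀ (x : M) (α : TangentSpace 𝓘(ℝ, E) x →L[ℝ] ℝ), α (s x α) = 0) ∧
    ∀ (f g : C^∞⟮𝓘(ℝ, E), M; ℝ⟯) (x : M),
      P f g x = mfderiv 𝓘(ℝ, E) 𝓘(ℝ, ℝ) g x (s x (mfderiv 𝓘(ℝ, E) 𝓘(ℝ, ℝ) f x))

end JacobiManifold

section Schouten

variable {C : Type*} [CommRing C]

/-- The Schouten bracket `[Z, P]` of a vector field and a bivector field, on functions. -/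
def schoutenVectorBivector (Z : C → C) (P : C → C → C) (f g : C) : C :=
  Z (P f g) - P (Z f) g - P f (Z g)

/-- The Schouten bracket `[P, Q]` of two bivector fields, on functions. The sign is that of the
derived bracket: `[a∧b, c∧d] = a∧[b,c]∧d + [a,c]∧b∧d - c∧a∧[b,d] - c∧[a,d]∧b`. -/
def schoutenBivector (P Q : C → C → C) (f g h : C) : C :=
  P f (Q g h) + P g (Q h f) + P h (Q f g) + (Q f (P g h) + Q g (P h f) + Q h (P f g))

/-- The wedge product of a vector field and a bivector field, on functions. -/
def wedgeVectorBivector (Z : C → C) (P : C → C → C) (f g h : C) : C :=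
  Z f * P g h + Z g * P h f + Z h * P f g

end Schouten

/-- `(P, Z)` is a Jacobi structure on the manifold: `[P, P] = -2 Z ∧ P` and `[Z, P] = 0`. -/
structure IsJacobiStructure {E : Type*} [NormedAddCommGroup E] [NormedSpace ℝ E] {M : Type*}
    [TopologicalSpace M] [ChartedSpace E M] [IsManifold 𝓘(ℝ, E) ∞ M]
    (P : C^∞⟮𝓘(ℝ, E), M; ℝ⟯ → C^∞⟮𝓘(ℝ, E), M; ℝ⟯ → C^∞⟮𝓘(ℝ, E), M; ℝ⟯)
    (Z : C^∞⟮𝓘(ℝ, E), M; ℝ⟯ → C^∞⟮𝓘(ℝ, E), M; ℝ⟯) : Prop where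
  bivector : IsBivectorField P
  vector : IsVectorField Z
  schouten_bivector : ∀ f g h, schoutenBivector P P f g h = -(2 * wedgeVectorBivector Z P f g h)
  schouten_vector : ∀ f g, schoutenVectorBivector Z P f g = 0

end BigBracket

/-! Write d for `preJacobiDifferential` and [·,·] for `preJacobiBracket`. Everything comes from the
compatibility condition with a = f a function and b of degree at most one. Since [f, g] = 0, it
gives [df, g] = [f, dg] = -[dg, f], so [df, g] is skew in f and g. Expanding in the big bracket,
[df, g] = P(g, f) + f Z(g) + g W(f) + c f g, where Z = {{μ, X}, ·}, W = {{ν, φ}, ·}, c = {X, φ} and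
P(f, g) = {{μ, f}, {ν, g}}. Skewness at f = g = 1 gives c = 0, at f = 1 it gives W = -Z, and then P
itself is skew. Hence [df, g] = K(g, f) with K(f, g) = P(f, g) + g Z(f) - f Z(g).

For b = dg and d² = 0 the condition reads [df, dg] = d[f, dg]. By {μ, μ} = 0 and {μ, φ} = 0,
sections act on functions through [a, ·] compatibly with commutators (`preJacobiBracket_jacobi`), so
applying both sides to h yields the Jacobi identity of K. Its case h = 1 is the invariance of P
under Z; what remains is that the cyclic sums of P(f, P(g, h)) and Z(f) P(g, h) agree, which is the
Jacobi condition for (P, -Z).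

The algebraic input is that symbols satisfy the graded Poisson identities and that an operator of
order k lowers the degree of forms by at most k. Brackets of impossible bidegree therefore vanish,
and bidegrees (0,0) and (1,0) contain only functions and contractions (`exists_eq_ofFun`,
`exists_eq_ofVector`). The geometric input is that linear forms on sections of A* are sections of A
(`pairing_surjective`), which makes dg an admissible b, and that derivations of the smooth functions
are vector fields and skew biderivations are bivector fields, by Hadamard's lemma. -/

namespace BigBracket

/-! ### Signs of the supercommutator on elements of definite parity. -/

section SuperCommutatorOfParity

variable {B : Type*} [Ring B] [Algebra ℝ B]

theorem neg_one_pow_smul_smul {V : Type*} [AddCommGroup V] [Module ℝ V] (n : ℕ) (v : V) :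
    (-1 : ℝ) ^ n • (-1 : ℝ) ^ n • v = v := by
  rw [smul_smul, ← mul_pow]; simp

/-- `superComm` splits only `P` into even and odd parts; the parity of `Q` enters through `s Q`, and
only when `P` is odd. -/
theorem superComm_of_parity {s : B →ₐ[ℝ] B} {P Q : B} {m n : ℕ}
    (hP : s P = (-1 : ℝ) ^ m • P) (hQ : s Q = (-1 : ℝ) ^ n • Q) :
    superComm s P Q = P * Q - (-1 : ℝ) ^ (m * n) • (Q * P) := by
  rcases Nat.even_or_odd m with hm | hm
  · rw [hm.neg_one_pow, one_smul] at hP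
    rw [superComm, evenPart_of_even hP, oddPart_of_even hP, (hm.mul_right n).neg_one_pow]
    simp
  · rw [hm.neg_one_pow, neg_one_smul] at hP
    rw [superComm, evenPart_of_odd hP, oddPart_of_odd hP, pow_mul, hm.neg_one_pow, hQ]
    simp

theorem map_superComm_of_parity {s : B →ₐ[ℝ] B} {P Q : B} {m n : ℕ}
    (hP : s P = (-1 : ℝ) ^ m • P) (hQ : s Q = (-1 : ℝ) ^ n • Q) :
    s (superComm s P Q) = (-1 : ℝ) ^ (m + n) • superComm s P Q := by
  rw [superComm_of_parity hP hQ]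
  simp only [map_sub, map_mul, map_smul, hP, hQ, smul_mul_assoc, mul_smul_comm, pow_add]
  module

theorem map_mul_of_parity {s : B →ₐ[ℝ] B} {P Q : B} {m n : ℕ}
    (hP : s P = (-1 : ℝ) ^ m • P) (hQ : s Q = (-1 : ℝ) ^ n • Q) :
    s (P * Q) = (-1 : ℝ) ^ (m + n) • (P * Q) := by
  rw [map_mul, hP, hQ, smul_mul_smul_comm, pow_add]

theorem superComm_symm_of_parity {s : B →ₐ[ℝ] B} {P Q : B} {m n : ℕ}
    (hP : s P = (-1 : ℝ) ^ m • P) (hQ : s Q = (-1 : ℝ) ^ n • Q) :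
    superComm s P Q = -((-1 : ℝ) ^ (m * n) • superComm s Q P) := by
  rw [superComm_of_parity hP hQ, superComm_of_parity hQ hP, mul_comm n m, smul_sub,
    neg_one_pow_smul_smul]
  abel

theorem superComm_mul_right_of_parity {s : B →ₐ[ℝ] B} {P Q R : B} {m n l : ℕ}
    (hP : s P = (-1 : ℝ) ^ m • P) (hQ : s Q = (-1 : ℝ) ^ n • Q) (hR : s R = (-1 : ℝ) ^ l • R) :
    superComm s P (Q * R) = superComm s P Q * R + (-1 : ℝ) ^ (m * n) • (Q * superComm s P R) := by
  rw [superComm_of_parity hP hQ, superComm_of_parity hP hR,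
    superComm_of_parity hP (map_mul_of_parity hQ hR)]
  simp only [mul_add, pow_add, sub_mul, mul_sub, smul_sub, smul_mul_assoc, mul_smul_comm, mul_assoc,
    mul_smul]
  abel

theorem superComm_jacobi_of_parity {s : B →ₐ[ℝ] B} {P Q R : B} {m n l : ℕ}
    (hP : s P = (-1 : ℝ) ^ m • P) (hQ : s Q = (-1 : ℝ) ^ n • Q) (hR : s R = (-1 : ℝ) ^ l • R) :
    superComm s P (superComm s Q R) =
      superComm s (superComm s P Q) R + (-1 : ℝ) ^ (m * n) • superComm s Q (superComm s P R) := by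
  rw [superComm_of_parity hP (map_superComm_of_parity hQ hR),
    superComm_of_parity (map_superComm_of_parity hP hQ) hR,
    superComm_of_parity hQ (map_superComm_of_parity hP hR),
    superComm_of_parity hP hQ, superComm_of_parity hP hR, superComm_of_parity hQ hR]
  simp only [mul_add, add_mul, pow_add, sub_mul, mul_sub, smul_sub, smul_mul_assoc, mul_smul_comm,
    mul_assoc, mul_smul, mul_comm n m, neg_one_pow_smul_smul]
  module

end SuperCommutatorOfParity

/-! ### Graded Poisson identities for principal symbols. -/

namespace AlmostSuperComm

open Polynomial

section CentralVariable
variable {B : Type*} [Ring B]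

theorem X_mul_left_cancel {p q : B[X]} (h : X * p = X * q) : p = q := by
  ext n
  simpa using congrArg (fun r => r.coeff (n + 1)) h

theorem mul_X_mul (p q : B[X]) : p * (X * q) = X * (p * q) := by
  rw [← mul_assoc, ← X_mul, mul_assoc]

end CentralVariable

variable {B : Type*} [Ring B] [Algebra ℝ B] (D : AlmostSuperComm B)

/-- Elements of order zero supercommute, so the constant coefficient vanishes and `divX` loses
nothing. As `X` is central and cancellable, identities for the bracket may be checked on
supercommutators in `B[X]`. -/
theorem X_mul_reesBracket (p q : D.rees) :
    X * (D.reesBracket p q : B[X]) = superComm D.polyParity (p : B[X]) q := by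
  have h0 : (superComm D.polyParity (p : B[X]) q).coeff 0 = 0 := by
    rw [coeff_superComm]
    refine Finset.sum_eq_zero fun x hx => D.eq_zero ?_
    have h := Finset.HasAntidiagonal.mem_antidiagonal.mp hx
    have := D.superComm_mem (p.2 x.1) (q.2 x.2)
    rwa [h] at this
  have h := X_mul_divX_add (superComm D.polyParity (p : B[X]) q)
  rwa [h0, C_0, add_zero] at h

theorem polyParity_X : D.polyParity X = X := by
  simp [polyParity, mapAlgHom]

theorem superComm_X_mul_left (p q : B[X]) :
    superComm D.polyParity (X * p) q = X * superComm D.polyParity p q := by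
  simp only [superComm, evenPart, oddPart, map_mul, polyParity_X, ← mul_add, ← mul_sub,
    mul_smul_comm, mul_assoc, mul_X_mul]
  simp only [mul_sub, mul_smul_comm]

theorem superComm_X_mul_right (p q : B[X]) :
    superComm D.polyParity p (X * q) = X * superComm D.polyParity p q := by
  simp only [superComm, map_mul, polyParity_X, mul_sub, mul_assoc, mul_X_mul]

/-- Multiplication by `X` raises the index of a coefficient but not its order, so it lands in
`lowerOrder`. -/
theorem toGr_eq_zero_of_X_mul {p q : D.rees} (h : (p : B[X]) = X * (q : B[X])) : D.toGr p = 0 := by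
  rw [← map_zero D.toGr, toGr_eq_toGr, sub_zero]
  intro k
  rw [h]
  cases k with
  | zero => simp
  | succ k => simpa using q.2 k

/-- The symbol `F` is represented by an element of parity `n`. -/
def HasParity (n : ℕ) (F : D.Gr) : Prop :=
  ∃ p : D.rees, D.toGr p = F ∧ D.polyParity (p : B[X]) = (-1 : ℝ) ^ n • (p : B[X])

variable {D} {m n l : ℕ} {F G H : D.Gr}

/-- The supercommutator of representatives is `X` times their bracket in the Rees algebra, hence
zero in the quotient. -/
theorem HasParity.mul_comm (hF : D.HasParity m F) (hG : D.HasParity n G) :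
    F * G = (-1 : ℝ) ^ (m * n) • (G * F) := by
  obtain ⟨p, rfl, hp⟩ := hF
  obtain ⟨q, rfl, hq⟩ := hG
  rw [← sub_eq_zero, ← map_mul, ← map_mul, ← map_smul, ← map_sub]
  refine D.toGr_eq_zero_of_X_mul (q := D.reesBracket p q) ?_
  rw [X_mul_reesBracket, superComm_of_parity hp hq]
  rfl

theorem HasParity.bracket_symm (hF : D.HasParity m F) (hG : D.HasParity n G) :
    D.bracket F G = -((-1 : ℝ) ^ (m * n) • D.bracket G F) := by
  obtain ⟨p, rfl, hp⟩ := hF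
  obtain ⟨q, rfl, hq⟩ := hG
  have : D.reesBracket p q = -((-1 : ℝ) ^ (m * n) • D.reesBracket q p) := by
    refine Subtype.ext (X_mul_left_cancel ?_)
    rw [X_mul_reesBracket, superComm_symm_of_parity hp hq, ← X_mul_reesBracket]
    simp
  change D.toGr (D.reesBracket p q) = -((-1 : ℝ) ^ (m * n) • D.toGr (D.reesBracket q p))
  rw [this, map_neg, map_smul]

theorem HasParity.bracket_mul (hF : D.HasParity m F) (hG : D.HasParity n G)
    (hH : D.HasParity l H) :
    D.bracket F (G * H) = D.bracket F G * H + (-1 : ℝ) ^ (m * n) • (G * D.bracket F H) := by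
  obtain ⟨p, rfl, hp⟩ := hF
  obtain ⟨q, rfl, hq⟩ := hG
  obtain ⟨r, rfl, hr⟩ := hH
  have : D.reesBracket p (q * r) =
      D.reesBracket p q * r + (-1 : ℝ) ^ (m * n) • (q * D.reesBracket p r) := by
    refine Subtype.ext (X_mul_left_cancel ?_)
    rw [X_mul_reesBracket, Subalgebra.coe_mul, superComm_mul_right_of_parity hp hq hr,
      ← X_mul_reesBracket, ← X_mul_reesBracket]
    simp only [Subalgebra.coe_add, Subalgebra.coe_mul, Subalgebra.coe_smul, mul_add,
      mul_smul_comm, mul_assoc, mul_X_mul]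
  rw [← map_mul]
  change D.toGr (D.reesBracket p (q * r)) =
    D.toGr (D.reesBracket p q) * D.toGr r + _ • (D.toGr q * D.toGr (D.reesBracket p r))
  rw [this, map_add, map_smul, map_mul, map_mul]

/-- Nested brackets involve two divisions by `X`; after cancelling `X` twice the claim is the Jacobi
identity of supercommutators. -/
theorem HasParity.bracket_bracket (hF : D.HasParity m F) (hG : D.HasParity n G)
    (hH : D.HasParity l H) :
    D.bracket F (D.bracket G H) =
      D.bracket (D.bracket F G) H + (-1 : ℝ) ^ (m * n) • D.bracket G (D.bracket F H) := by
  obtain ⟨p, rfl, hp⟩ := hF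
  obtain ⟨q, rfl, hq⟩ := hG
  obtain ⟨r, rfl, hr⟩ := hH
  have : D.reesBracket p (D.reesBracket q r) = D.reesBracket (D.reesBracket p q) r +
      (-1 : ℝ) ^ (m * n) • D.reesBracket q (D.reesBracket p r) := by
    refine Subtype.ext (X_mul_left_cancel (X_mul_left_cancel ?_))
    rw [Subalgebra.coe_add, Subalgebra.coe_smul, mul_add, mul_add, mul_smul_comm, mul_smul_comm,
      X_mul_reesBracket, X_mul_reesBracket, X_mul_reesBracket, ← superComm_X_mul_right,
      ← superComm_X_mul_left, ← superComm_X_mul_right, X_mul_reesBracket, X_mul_reesBracket,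
      X_mul_reesBracket]
    exact superComm_jacobi_of_parity hp hq hr
  change D.toGr (D.reesBracket p (D.reesBracket q r)) =
    D.toGr (D.reesBracket (D.reesBracket p q) r) + _ •
      D.toGr (D.reesBracket q (D.reesBracket p r))
  rw [this, map_add, map_smul]

theorem HasParity.mul (hF : D.HasParity m F) (hG : D.HasParity n G) :
    D.HasParity (m + n) (F * G) := by
  obtain ⟨p, rfl, hp⟩ := hF
  obtain ⟨q, rfl, hq⟩ := hG
  exact ⟨p * q, map_mul _ _ _, map_mul_of_parity hp hq⟩

theorem hasParity_symbol {k n : ℕ} {P : B} (h : P ∈ D.order (k + 1))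
    (hP : D.parity P = (-1 : ℝ) ^ n • P) : D.HasParity n (D.symbol k P h) :=
  ⟨_, rfl, by
    change (monomial k P).map (D.parity : B →+* B) = (-1 : ℝ) ^ n • monomial k P
    rw [map_monomial, smul_monomial, ← hP]; rfl⟩

theorem coeff_superComm_monomial (i j : ℕ) (P Q : B) (n : ℕ) :
    (superComm D.polyParity (monomial i P) (monomial j Q)).coeff n =
      if i + j = n then superComm D.parity P Q else 0 := by
  rw [coeff_superComm]
  split_ifs with h
  · rw [Finset.sum_eq_single (i, j)]
    · rw [coeff_monomial_same, coeff_monomial_same]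
    · rintro ⟨a, b⟩ hx hne
      have := Finset.HasAntidiagonal.mem_antidiagonal.mp hx
      by_cases ha : i = a
      · have hb : b ≠ j := by rintro rfl; exact hne (by rw [ha])
        rw [coeff_monomial_of_ne _ hb, superComm_zero_right]
      · rw [coeff_monomial_of_ne _ (Ne.symm ha), superComm_zero_left]
    · exact fun hn => absurd (Finset.HasAntidiagonal.mem_antidiagonal.mpr h) hn
  · refine Finset.sum_eq_zero fun x hx => ?_
    have := Finset.HasAntidiagonal.mem_antidiagonal.mp hx
    by_cases ha : i = x.1
    · rw [coeff_monomial_of_ne _ (show x.2 ≠ j by omega), superComm_zero_right]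
    · rw [coeff_monomial_of_ne _ (Ne.symm ha), superComm_zero_left]

theorem bracket_symbol {i j : ℕ} {P Q : B} (hP : P ∈ D.order (i + 1)) (hQ : Q ∈ D.order (j + 1))
    {k : ℕ} (hk : i + j = k + 1) (h : superComm D.parity P Q ∈ D.order (k + 1)) :
    D.bracket (D.symbol i P hP) (D.symbol j Q hQ) = D.symbol k (superComm D.parity P Q) h := by
  change D.toGr (D.reesBracket _ _) = D.toGr _
  congr 1
  refine Subtype.ext ?_
  change divX _ = _
  ext n
  rw [coeff_divX]
  refine (coeff_superComm_monomial (D := D) i j P Q (n + 1)).trans ?_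
  rw [coeff_monomial]
  simp [hk]

/-- The case that `bracket_symbol` cannot cover: the order 0 + 0 - 1 does not exist, and `divX`
discards the only possible coefficient. -/
theorem bracket_symbol_zero {P Q : B} (hP : P ∈ D.order (0 + 1)) (hQ : Q ∈ D.order (0 + 1)) :
    D.bracket (D.symbol 0 P hP) (D.symbol 0 Q hQ) = 0 := by
  change D.toGr (D.reesBracket _ _) = _
  rw [← map_zero D.toGr]
  congr 1
  refine Subtype.ext ?_
  change divX _ = _
  ext n
  rw [coeff_divX]
  exact (coeff_superComm_monomial (D := D) 0 0 P Q (n + 1)).trans (if_neg (by omega))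

theorem symbol_eq_zero {k : ℕ} {P : B} {h : P ∈ D.order (k + 1)} :
    D.symbol k P h = 0 ↔ P ∈ D.order k := by
  rw [symbol, ← map_zero D.toGr, toGr_eq_toGr, sub_zero]
  refine ⟨fun hk => by simpa using hk k, fun hP j => ?_⟩
  change (monomial k P).coeff j ∈ _
  rw [coeff_monomial]
  split_ifs with hj
  · exact hj ▸ hP
  · exact Submodule.zero_mem _

/-- Different orders occupy different coefficients of the Rees polynomial, so they vanish
separately. -/
theorem symbol_add_symbol_eq_zero {i j : ℕ} (hij : i ≠ j) {P Q : B} {hP : P ∈ D.order (i + 1)}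
    {hQ : Q ∈ D.order (j + 1)} (h : D.symbol i P hP + D.symbol j Q hQ = 0) :
    D.symbol i P hP = 0 ∧ D.symbol j Q hQ = 0 := by
  rw [symbol_eq_zero, symbol_eq_zero]
  rw [symbol, symbol, ← map_add, ← map_zero D.toGr, toGr_eq_toGr, sub_zero] at h
  have h1 := h i
  have h2 := h j
  simp only [Subalgebra.coe_add, coeff_add, coeff_monomial, if_pos, if_neg hij, if_neg hij.symm,
    add_zero, zero_add] at h1 h2
  exact ⟨h1, h2⟩

theorem symbol_add {k : ℕ} {P Q : B} (hP : P ∈ D.order (k + 1)) (hQ : Q ∈ D.order (k + 1)) :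
    D.symbol k P hP + D.symbol k Q hQ = D.symbol k (P + Q) (Submodule.add_mem _ hP hQ) := by
  rw [symbol, symbol, ← map_add]
  congr 1
  exact Subtype.ext (map_add (monomial k) P Q).symm

theorem symbol_smul {k : ℕ} (c : ℝ) {P : B} (hP : P ∈ D.order (k + 1)) :
    c • D.symbol k P hP = D.symbol k (c • P) (Submodule.smul_mem _ c hP) := by
  rw [symbol, symbol, ← map_smul]
  congr 1
  exact Subtype.ext (smul_monomial c k P)

theorem symbol_congr {k : ℕ} {P Q : B} (h : P = Q) (hP : P ∈ D.order (k + 1))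
    (hQ : Q ∈ D.order (k + 1)) : D.symbol k P hP = D.symbol k Q hQ := by
  subst h
  rfl

theorem symbol_mul {i j : ℕ} {P Q : B} (hP : P ∈ D.order (i + 1)) (hQ : Q ∈ D.order (j + 1))
    (h : P * Q ∈ D.order (i + j + 1)) :
    D.symbol i P hP * D.symbol j Q hQ = D.symbol (i + j) (P * Q) h := by
  rw [symbol, symbol, ← map_mul]
  congr 1
  exact Subtype.ext (monomial_mul_monomial _ _ _ _)

end AlmostSuperComm

/-! ### Operators on the exterior algebra, graded by weight. -/

section ExteriorPowers

variable {C N : Type*} [CommRing C] [AddCommGroup N] [Module C N]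

theorem mem_exteriorPower_zero {a : ExteriorAlgebra C N} :
    a ∈ ⋀[C]^0 N ↔ ∃ c, algebraMap C (ExteriorAlgebra C N) c = a := by
  rw [ExteriorAlgebra.exteriorPower, pow_zero, Submodule.mem_one]

theorem algebraMap_mem_exteriorPower (c : C) :
    algebraMap C (ExteriorAlgebra C N) c ∈ ⋀[C]^0 N :=
  mem_exteriorPower_zero.mpr ⟨c, rfl⟩

theorem ι_mem_exteriorPower (v : N) : ExteriorAlgebra.ι C v ∈ ⋀[C]^1 N := by
  rw [ExteriorAlgebra.exteriorPower, pow_one]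
  exact LinearMap.mem_range_self _ v

end ExteriorPowers

section Weights

variable {C N : Type*} [CommRing C] [Algebra ℝ C] [AddCommGroup N] [Module C N] [Module ℝ N]
  [IsScalarTower ℝ C N]

theorem end_ext_of_homogeneous {P Q : Module.End ℝ (ExteriorAlgebra C N)}
    (h : ∀ (i : ℕ) (w : ExteriorAlgebra C N), w ∈ ⋀[C]^i N → P w = Q w) : P = Q := by
  ext a
  induction a using DirectSum.Decomposition.inductionOn fun i => ⋀[C]^i N with
  | zero => simp
  | add x y hx hy => rw [map_add, map_add, hx, hy]
  | @homogeneous i x => exact h i x x.2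

namespace HasWeight

variable {P Q : Module.End ℝ (ExteriorAlgebra C N)} {m m' : ℤ}

theorem mul (hP : HasWeight m P) (hQ : HasWeight m' Q) : HasWeight (m + m') (P * Q) := by
  intro i w hw
  rw [Module.End.mul_apply]
  by_cases hneg : (i : ℤ) + m' < 0
  · rw [(hQ i w hw).2 hneg, map_zero]
    exact ⟨fun j _ => Submodule.zero_mem _, fun _ => rfl⟩
  · obtain ⟨l, hl⟩ := Int.eq_ofNat_of_zero_le (not_lt.mp hneg)
    have hQw := (hQ i w hw).1 l hl.symm
    exact ⟨fun j hj => (hP l _ hQw).1 j (by omega), fun h => (hP l _ hQw).2 (by omega)⟩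

theorem add (hP : HasWeight m P) (hQ : HasWeight m Q) : HasWeight m (P + Q) := fun i w hw =>
  ⟨fun j hj => Submodule.add_mem _ ((hP i w hw).1 j hj) ((hQ i w hw).1 j hj), fun h => by
    rw [LinearMap.add_apply, (hP i w hw).2 h, (hQ i w hw).2 h, add_zero]⟩

theorem smul (c : ℝ) (hP : HasWeight m P) : HasWeight m (c • P) := fun i w hw =>
  ⟨fun j hj => by
    rw [LinearMap.smul_apply, ← algebraMap_smul C]
    exact Submodule.smul_mem _ _ ((hP i w hw).1 j hj), fun h => by
    rw [LinearMap.smul_apply, (hP i w hw).2 h, smul_zero]⟩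

theorem sub (hP : HasWeight m P) (hQ : HasWeight m Q) : HasWeight m (P - Q) := by
  rw [sub_eq_add_neg, ← neg_one_smul ℝ Q]
  exact hP.add (hQ.smul _)

/-- The parity of an operator is its weight modulo 2. The natural number `n` is any representative
of that class, so that weight -1 can be treated with `n = 1`. -/
theorem opParity_eq (hP : HasWeight m P) {n : ℕ} (hn : Even (m + n)) :
    opParity (ExteriorAlgebra C N) P = (-1 : ℝ) ^ n • P := by
  refine end_ext_of_homogeneous fun i w hw => ?_
  change extParity (P (extParity w)) = (-1 : ℝ) ^ n • P w
  rw [extParity_of_mem hw, map_smul, map_smul]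
  by_cases hneg : (i : ℤ) + m < 0
  · rw [(hP i w hw).2 hneg, map_zero, smul_zero, smul_zero]
  · obtain ⟨l, hl⟩ := Int.eq_ofNat_of_zero_le (not_lt.mp hneg)
    rw [extParity_of_mem ((hP i w hw).1 l hl.symm), smul_smul, ← pow_add]
    congr 1
    have : Even ((i + l) + n) := by
      rw [← Int.even_coe_nat]
      push_cast
      rw [← hl, show (i : ℤ) + (i + m) + n = 2 * i + (m + n) by ring]
      exact (even_two_mul _).add hn
    rcases Nat.even_or_odd n with h | h
    · rw [h.neg_one_pow, Even.neg_one_pow ((Nat.even_add.mp this).mpr h)]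
    · rw [h.neg_one_pow, Odd.neg_one_pow]
      rw [← Nat.not_even_iff_odd] at h ⊢
      exact fun h' => h ((Nat.even_add.mp this).mp h')

theorem exists_opParity_eq (hP : HasWeight m P) :
    opParity (ExteriorAlgebra C N) P = (-1 : ℝ) ^ m.natAbs • P := by
  refine hP.opParity_eq ?_
  rw [Int.even_add, Int.even_coe_nat, Int.natAbs_even]

theorem superComm (hP : HasWeight m P) (hQ : HasWeight m' Q) :
    HasWeight (m + m') (superComm (opParity (ExteriorAlgebra C N)) P Q) := by
  rw [superComm_of_parity hP.exists_opParity_eq hQ.exists_opParity_eq]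
  refine (hP.mul hQ).sub (HasWeight.smul _ ?_)
  rw [add_comm]
  exact hQ.mul hP

end HasWeight

theorem hasWeight_mulLeft {j : ℕ} {a : ExteriorAlgebra C N} (ha : a ∈ ⋀[C]^j N) :
    HasWeight (j : ℤ) (LinearMap.mulLeft ℝ a) := fun i w hw =>
  ⟨fun l hl => by
    obtain rfl : l = j + i := by omega
    exact SetLike.GradedMul.mul_mem ha hw, fun h => by omega⟩

theorem hasWeight_mulLeft_algebraMap (c : C) :
    HasWeight 0 (LinearMap.mulLeft ℝ (algebraMap C (ExteriorAlgebra C N) c)) :=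
  hasWeight_mulLeft (algebraMap_mem_exteriorPower c)

theorem hasWeight_mulLeft_ι (v : N) :
    HasWeight 1 (LinearMap.mulLeft ℝ (ExteriorAlgebra.ι C v)) :=
  hasWeight_mulLeft (ι_mem_exteriorPower v)

theorem hasWeight_euler : HasWeight 0 (euler C N) := fun i w hw =>
  ⟨fun j hj => by
    obtain rfl : j = i := by omega
    rw [euler_of_mem hw, ← algebraMap_smul C]
    exact Submodule.smul_mem _ _ hw, fun h => by omega⟩

theorem contraction_algebraMap (d : Module.Dual C N) (c : C) :
    contraction d (algebraMap C (ExteriorAlgebra C N) c) = 0 :=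
  CliffordAlgebra.contractLeft_algebraMap (Q := (0 : QuadraticForm C N)) d c

theorem contraction_ι (d : Module.Dual C N) (v : N) :
    contraction d (ExteriorAlgebra.ι C v) = algebraMap C _ (d v) :=
  CliffordAlgebra.contractLeft_ι (Q := (0 : QuadraticForm C N)) d v

theorem hasWeight_contraction (d : Module.Dual C N) : HasWeight (-1) (contraction d) := by
  intro i w hw
  suffices h : (∀ j, i = j + 1 → contraction d w ∈ ⋀[C]^j N) ∧ (i = 0 → contraction d w = 0) from
    ⟨fun j hj => h.1 j (by omega), fun hi => h.2 (by omega)⟩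
  induction hw using Submodule.pow_induction_on_left' with
  | algebraMap r =>
    rw [contraction_algebraMap]
    exact ⟨fun j _ => Submodule.zero_mem _, fun _ => rfl⟩
  | add x y i hx hy ihx ihy =>
    rw [map_add]
    exact ⟨fun j hj => Submodule.add_mem _ (ihx.1 j hj) (ihy.1 j hj), fun h => by
      rw [ihx.2 h, ihy.2 h, add_zero]⟩
  | mem_mul m hm i x hx ih =>
    obtain ⟨v, rfl⟩ := hm
    refine ⟨fun j hj => ?_, fun h => absurd h (Nat.succ_ne_zero i)⟩
    obtain rfl : i = j := by omega
    rw [contraction_mul, contraction_ι, extParity_ι, ← Algebra.smul_def, neg_mul]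
    refine Submodule.add_mem _ (Submodule.smul_mem _ _ hx) (Submodule.neg_mem _ ?_)
    cases i with
    | zero => rw [ih.2 rfl, mul_zero]; exact Submodule.zero_mem _
    | succ l =>
      rw [add_comm l 1]
      exact SetLike.GradedMul.mul_mem (ι_mem_exteriorPower v) (ih.1 l rfl)

/-- The Euler derivation takes the value `i + m` after `P` and `i` before it; the difference is the
weight. -/
theorem superComm_euler {m : ℤ} {P : Module.End ℝ (ExteriorAlgebra C N)} (hP : HasWeight m P) :
    superComm (opParity (ExteriorAlgebra C N)) (euler C N) P = (m : ℝ) • P := by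
  rw [superComm_of_parity (hasWeight_euler.opParity_eq (n := 0) (by simp)) hP.exists_opParity_eq]
  refine end_ext_of_homogeneous fun i w hw => ?_
  simp only [zero_mul, pow_zero, one_smul, LinearMap.sub_apply, Module.End.mul_apply,
    euler_of_mem hw, map_smul, LinearMap.smul_apply]
  by_cases hneg : (i : ℤ) + m < 0
  · rw [(hP i w hw).2 hneg]; simp
  · obtain ⟨l, hl⟩ := Int.eq_ofNat_of_zero_le (not_lt.mp hneg)
    have hl' : (l : ℝ) = i + m := by exact_mod_cast hl.symm
    rw [euler_of_mem ((hP i w hw).1 l hl.symm), hl']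
    module

/-- An operator that commutes with multiplication by functions and covectors and kills `1` is
zero. -/
theorem eq_zero_of_superComm_eq_zero {P : Module.End ℝ (ExteriorAlgebra C N)} {n : ℕ}
    (hn : opParity (ExteriorAlgebra C N) P = (-1 : ℝ) ^ n • P) (h1 : P 1 = 0)
    (hC : ∀ c, superComm (opParity (ExteriorAlgebra C N)) P
      (LinearMap.mulLeft ℝ (algebraMap C _ c)) = 0)
    (hN : ∀ v, superComm (opParity (ExteriorAlgebra C N)) P
      (LinearMap.mulLeft ℝ (ExteriorAlgebra.ι C v)) = 0) : P = 0 := by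
  have key : ∀ {a : ExteriorAlgebra C N} {l : ℕ},
      HasWeight (l : ℤ) (LinearMap.mulLeft ℝ a) →
      superComm (opParity (ExteriorAlgebra C N)) P (LinearMap.mulLeft ℝ a) = 0 →
      ∀ b, P b = 0 → P (a * b) = 0 := by
    intro a l ha h b hb
    rw [superComm_of_parity hn ha.exists_opParity_eq] at h
    have := LinearMap.congr_fun h b
    simpa [hb] using this
  ext a
  rw [LinearMap.zero_apply]
  -- Left multiplications by functions and covectors build the whole algebra from `1`, and `key`
  -- carries vanishing through each of them.
  refine CliffordAlgebra.left_induction (Q := (0 : QuadraticForm C N))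
    (P := fun a => P a = 0) (fun r => ?_) (fun x y hx hy => ?_) (fun x v hx => ?_) a
  · rw [← mul_one (algebraMap C _ r)]
    exact key (l := 0) (hasWeight_mulLeft_algebraMap r) (hC r) 1 h1
  · rw [map_add, hx, hy, add_zero]
  · exact key (l := 1) (hasWeight_mulLeft_ι v) (hN v) x hx

theorem HasWeight.map_one_eq_zero {m : ℤ} {P : Module.End ℝ (ExteriorAlgebra C N)}
    (hP : HasWeight m P) (hm : m < 0) : P 1 = 0 := by
  refine (hP 0 1 ?_).2 (by simpa using hm)
  simp

/-- A superdifferential operator of order `k` lowers the degree of forms by at most `k`. -/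
theorem HasWeight.eq_zero_of_mem_diffOp {n : ℕ} {m : ℤ} {P : Module.End ℝ (ExteriorAlgebra C N)}
    (hP : HasWeight m P) (h : P ∈ diffOp (ExteriorAlgebra C N) n) (hm : m + n ≤ 0) : P = 0 := by
  induction n generalizing m P with
  | zero => exact eq_zero_of_mem_diffOp_zero h
  | succ n ih =>
    push_cast at hm
    -- The commutator with a function keeps the weight and the one with a covector raises it by one,
    -- while both lower the order by one; the bound on `m + n` survives in either case.
    refine eq_zero_of_superComm_eq_zero hP.exists_opParity_eq
      (hP.map_one_eq_zero (by omega)) (fun c => ?_) (fun v => ?_)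
    · exact ih (hP.superComm (hasWeight_mulLeft_algebraMap c)) (h _) (by omega)
    · exact ih (hP.superComm (hasWeight_mulLeft_ι v)) (h _) (by omega)

/-- An operator of order zero is multiplication by its value at `1`, and weight zero puts that value
in degree zero. -/
theorem HasWeight.eq_mulLeft_algebraMap {P : Module.End ℝ (ExteriorAlgebra C N)}
    (hP : HasWeight 0 P) (h : P ∈ diffOp (ExteriorAlgebra C N) 1) :
    ∃ c : C, P = LinearMap.mulLeft ℝ (algebraMap C _ c) := by
  have h1 : P 1 ∈ ⋀[C]^0 N :=
    (hP 0 1 (by simp)).1 0 (by simp)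
  obtain ⟨c, hc⟩ := mem_exteriorPower_zero.mp h1
  exact ⟨c, by rw [hc]; exact eq_mulLeft_of_mem h⟩

/-- The commutator of `P` with a function has order zero and weight -1, so it vanishes and `P` is
linear over `C`. The form `d` is read off from `P` on covectors; `P - contraction d` then
supercommutes with all generators and kills `1`. -/
theorem HasWeight.eq_contraction {P : Module.End ℝ (ExteriorAlgebra C N)}
    (hP : HasWeight (-1) P) (h : P ∈ diffOp (ExteriorAlgebra C N) 2) :
    ∃ d : Module.Dual C N, P = contraction d := by
  have hpar : opParity (ExteriorAlgebra C N) P = (-1 : ℝ) ^ 1 • P := hP.opParity_eq (by simp)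
  have hcomm : ∀ (c : C) (a : ExteriorAlgebra C N), P (c • a) = c • P a := fun c a => by
    have h0 : HasWeight (-1 + 0) _ := hP.superComm (hasWeight_mulLeft_algebraMap c)
    have h1 := h0.eq_zero_of_mem_diffOp (h _) (by simp)
    rw [superComm_of_parity hpar
      ((hasWeight_mulLeft_algebraMap c).opParity_eq (n := 0) (by simp))] at h1
    have h2 := LinearMap.congr_fun h1 a
    simp only [mul_zero, pow_zero, one_smul, LinearMap.sub_apply, Module.End.mul_apply,
      LinearMap.mulLeft_apply, LinearMap.zero_apply, ← Algebra.smul_def] at h2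
    exact sub_eq_zero.mp h2
  have hmem : ∀ v : N, P (ExteriorAlgebra.ι C v) ∈ ⋀[C]^0 N := fun v =>
    (hP 1 _ (ι_mem_exteriorPower v)).1 0 (by simp)
  have hinv : ∀ v : N, algebraMap C (ExteriorAlgebra C N)
      (ExteriorAlgebra.algebraMapInv (P (ExteriorAlgebra.ι C v))) = P (ExteriorAlgebra.ι C v) := by
    intro v
    obtain ⟨c, hc⟩ := mem_exteriorPower_zero.mp (hmem v)
    rw [← hc, ExteriorAlgebra.algebraMap_leftInverse N c]
  let d : Module.Dual C N :=
    { toFun := fun v => ExteriorAlgebra.algebraMapInv (P (ExteriorAlgebra.ι C v))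
      map_add' := fun v w => by simp only [map_add]
      map_smul' := fun c v => by simp only [map_smul, hcomm, RingHom.id_apply] }
  refine ⟨d, sub_eq_zero.mp ?_⟩
  have hT : HasWeight (-1) (P - contraction d) := hP.sub (hasWeight_contraction d)
  have hTmem : P - contraction d ∈ diffOp (ExteriorAlgebra C N) 2 :=
    Submodule.sub_mem _ h (contraction_mem d)
  have hTpar := hT.opParity_eq (n := 1) (by simp)
  refine eq_zero_of_superComm_eq_zero hTpar (hT.map_one_eq_zero (by simp)) (fun c => ?_)
    (fun v => ?_)
  · exact (hT.superComm (hasWeight_mulLeft_algebraMap c)).eq_zero_of_mem_diffOp (hTmem _) (by simp)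
  · rw [eq_mulLeft_of_mem (hTmem (ExteriorAlgebra.ι C v)),
      superComm_of_parity hTpar ((hasWeight_mulLeft_ι v).opParity_eq (n := 1) (by decide))]
    have h0 : (P - contraction d) (ExteriorAlgebra.ι C v) = 0 := by
      rw [LinearMap.sub_apply, contraction_ι, ← hinv v]
      exact sub_self _
    have h1 := hT.map_one_eq_zero (by simp)
    simp only [LinearMap.sub_apply, Module.End.mul_apply, LinearMap.smul_apply,
      LinearMap.mulLeft_apply, mul_one] at h0 h1 ⊢
    rw [h0, h1]
    ext; simp

end Weights

/-! ### Symbols graded by order and weight. -/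

section SymbolsOfWeight

variable {C N : Type*} [CommRing C] [Algebra ℝ C] [AddCommGroup N] [Module C N] [Module ℝ N]
  [IsScalarTower ℝ C N]

variable (C N) in
/-- The principal symbols of order `k` of operators of weight `m`. -/
def symbolsOfWeight (k : ℕ) (m : ℤ) : Set (SuperFunctions C N) :=
  {x | ∃ (P : Module.End ℝ (ExteriorAlgebra C N))
      (h : P ∈ diffOp (ExteriorAlgebra C N) (k + 1)),
    HasWeight m P ∧ (diffOpFiltration (ExteriorAlgebra C N)).symbol k P h = x}

variable {i j k : ℕ} {m m' : ℤ} {x y : SuperFunctions C N}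

theorem bb_mem_symbolsOfWeight (hx : x ∈ symbolsOfWeight C N i m)
    (hy : y ∈ symbolsOfWeight C N j m') (hk : i + j = k + 1) :
    bb x y ∈ symbolsOfWeight C N k (m + m') := by
  obtain ⟨P, hP, hPm, rfl⟩ := hx
  obtain ⟨Q, hQ, hQm, rfl⟩ := hy
  have h := superComm_mem_diffOp hP hQ
  rw [hk] at h
  exact ⟨_, h, hPm.superComm hQm, (AlmostSuperComm.bracket_symbol hP hQ hk h).symm⟩

theorem bb_eq_zero_of_symbolsOfWeight_zero (hx : x ∈ symbolsOfWeight C N 0 m)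
    (hy : y ∈ symbolsOfWeight C N 0 m') : bb x y = 0 := by
  obtain ⟨P, hP, hPm, rfl⟩ := hx
  obtain ⟨Q, hQ, hQm, rfl⟩ := hy
  exact AlmostSuperComm.bracket_symbol_zero hP hQ

/-- In bidegree (k, l) the weight is l - k, so the hypothesis says that l would be negative. Integer
weights make it possible to name such brackets before discarding them. -/
theorem eq_zero_of_mem_symbolsOfWeight (hx : x ∈ symbolsOfWeight C N k m) (h : m + k < 0) :
    x = 0 := by
  obtain ⟨P, hP, hPm, rfl⟩ := hx
  obtain rfl := hPm.eq_zero_of_mem_diffOp hP (by push_cast; omega)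
  exact AlmostSuperComm.symbol_eq_zero.mpr (Submodule.zero_mem _)

theorem hasParity_of_mem_symbolsOfWeight (hx : x ∈ symbolsOfWeight C N k m) {n : ℕ}
    (hn : Even (m + n)) : (diffOpFiltration (ExteriorAlgebra C N)).HasParity n x := by
  obtain ⟨P, hP, hPm, rfl⟩ := hx
  exact AlmostSuperComm.hasParity_symbol hP (hPm.opParity_eq hn)

theorem exists_eq_ofFun (hx : x ∈ symbolsOfWeight C N 0 0) : ∃ f : C, x = ofFun f := by
  obtain ⟨P, hP, hPm, rfl⟩ := hx
  obtain ⟨c, rfl⟩ := hPm.eq_mulLeft_algebraMap hP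
  exact ⟨c, rfl⟩

theorem exists_eq_ofVector (hx : x ∈ symbolsOfWeight C N 1 (-1)) :
    ∃ d : Module.Dual C N, x = ofVector d := by
  obtain ⟨P, hP, hPm, rfl⟩ := hx
  obtain ⟨d, rfl⟩ := hPm.eq_contraction hP
  exact ⟨d, rfl⟩

theorem ofFun_mem (f : C) : ofFun f ∈ symbolsOfWeight C N 0 0 :=
  ⟨_, mulLeft_mem _, hasWeight_mulLeft_algebraMap f, rfl⟩

theorem ofCovector_mem (v : N) : ofCovector v ∈ symbolsOfWeight C N 0 1 :=
  ⟨_, mulLeft_mem _, hasWeight_mulLeft_ι v, rfl⟩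

theorem ofVector_mem (d : Module.Dual C N) : ofVector d ∈ symbolsOfWeight C N 1 (-1) :=
  ⟨_, contraction_mem d, hasWeight_contraction d, rfl⟩

theorem idFun_mem : idFun C N ∈ symbolsOfWeight C N 1 0 := ⟨_, euler_mem, hasWeight_euler, rfl⟩

theorem add_mem_symbolsOfWeight (hx : x ∈ symbolsOfWeight C N k m)
    (hy : y ∈ symbolsOfWeight C N k m) : x + y ∈ symbolsOfWeight C N k m := by
  obtain ⟨P, hP, hPm, rfl⟩ := hx
  obtain ⟨Q, hQ, hQm, rfl⟩ := hy
  exact ⟨_, _, hPm.add hQm, (AlmostSuperComm.symbol_add hP hQ).symm⟩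

theorem mul_mem_symbolsOfWeight (hx : x ∈ symbolsOfWeight C N i m)
    (hy : y ∈ symbolsOfWeight C N j m') : x * y ∈ symbolsOfWeight C N (i + j) (m + m') := by
  obtain ⟨P, hP, hPm, rfl⟩ := hx
  obtain ⟨Q, hQ, hQm, rfl⟩ := hy
  have h : P * Q ∈ diffOp (ExteriorAlgebra C N) (i + j + 1) := by
    have := mul_mem_diffOp hP hQ
    rwa [show i + 1 + j = i + j + 1 by omega] at this
  exact ⟨_, h, hPm.mul hQm, (AlmostSuperComm.symbol_mul hP hQ h).symm⟩

theorem eq_zero_of_add_eq_zero (hx : x ∈ symbolsOfWeight C N i m)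
    (hy : y ∈ symbolsOfWeight C N j m') (hij : i ≠ j) (h : x + y = 0) : x = 0 ∧ y = 0 := by
  obtain ⟨P, hP, hPm, rfl⟩ := hx
  obtain ⟨Q, hQ, hQm, rfl⟩ := hy
  exact AlmostSuperComm.symbol_add_symbol_eq_zero hij h

theorem bb_idFun (hx : x ∈ symbolsOfWeight C N k m) : bb (idFun C N) x = (m : ℝ) • x := by
  obtain ⟨P, hP, hPm, rfl⟩ := hx
  have h := superComm_mem_diffOp euler_mem hP
  rw [add_comm 1 k] at h
  have h1 : bb (idFun C N) ((diffOpFiltration (ExteriorAlgebra C N)).symbol k P hP) =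
    (diffOpFiltration (ExteriorAlgebra C N)).symbol k _ h :=
    AlmostSuperComm.bracket_symbol (D := diffOpFiltration (ExteriorAlgebra C N)) (i := 1)
      (P := euler C N) euler_mem hP (add_comm 1 k) h
  have h2 : (m : ℝ) • (diffOpFiltration (ExteriorAlgebra C N)).symbol k P hP = _ :=
    AlmostSuperComm.symbol_smul (m : ℝ) hP
  rw [h1, h2]
  exact AlmostSuperComm.symbol_congr (superComm_euler hPm) _ _

/-- The operator is recovered from the coefficient at 0 and `f` from its value at `1`. This
transfers identities in the function algebra back to `C`. -/
theorem ofFun_injective : Function.Injective (ofFun : C → SuperFunctions C N) := by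
  intro f g h
  have hs : (diffOpFiltration (ExteriorAlgebra C N)).toGr _ =
    (diffOpFiltration (ExteriorAlgebra C N)).toGr _ := h
  rw [AlmostSuperComm.toGr_eq_toGr] at hs
  have h0 := hs 0
  have h1 : LinearMap.mulLeft ℝ (algebraMap C (ExteriorAlgebra C N) f) -
      LinearMap.mulLeft ℝ (algebraMap C (ExteriorAlgebra C N) g) = 0 := by
    simpa using AlmostSuperComm.eq_zero _ h0
  have h2 := LinearMap.congr_fun h1 1
  simp only [LinearMap.sub_apply, LinearMap.mulLeft_apply, mul_one, LinearMap.zero_apply] at h2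
  exact (ExteriorAlgebra.algebraMap_leftInverse N).injective (sub_eq_zero.mp h2)

theorem ofFun_add (f g : C) :
    (ofFun (f + g) : SuperFunctions C N) = ofFun f + ofFun g := by
  have := AlmostSuperComm.symbol_add (D := diffOpFiltration (ExteriorAlgebra C N)) (k := 0)
    (mulLeft_mem (algebraMap C _ f)) (mulLeft_mem (algebraMap C _ g))
  refine Eq.trans ?_ this.symm
  unfold ofFun ofForm
  congr 1
  ext; simp [add_mul]

theorem ofFun_mul (f g : C) :
    (ofFun (f * g) : SuperFunctions C N) = ofFun f * ofFun g := by
  have h : LinearMap.mulLeft ℝ (algebraMap C (ExteriorAlgebra C N) f) *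
      LinearMap.mulLeft ℝ (algebraMap C (ExteriorAlgebra C N) g) =
      LinearMap.mulLeft ℝ (algebraMap C (ExteriorAlgebra C N) (f * g)) := by
    ext; simp
  have := AlmostSuperComm.symbol_mul (D := diffOpFiltration (ExteriorAlgebra C N))
    (i := 0) (j := 0) (mulLeft_mem (algebraMap C _ f)) (mulLeft_mem (algebraMap C _ g))
    (h ▸ mulLeft_mem _)
  refine Eq.trans ?_ this.symm
  unfold ofFun ofForm
  congr 1
  exact h.symm

theorem ofFun_one : (ofFun (1 : C) : SuperFunctions C N) = 1 := by
  rw [← map_one (diffOpFiltration (ExteriorAlgebra C N)).toGr]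
  unfold ofFun ofForm AlmostSuperComm.symbol
  congr 1
  refine Subtype.ext ?_
  change Polynomial.monomial 0 _ = (1 : Polynomial _)
  rw [map_one, LinearMap.mulLeft_one]
  rfl

variable (C N) in
/-- Functions on the base, as a homomorphism into the functions on `T*ΠA`. -/
noncomputable def ofFunHom : C →+* SuperFunctions C N where
  toFun := ofFun
  map_one' := ofFun_one
  map_mul' := ofFun_mul
  map_zero' := by simpa using ofFun_add (N := N) (0 : C) 0
  map_add' := ofFun_add

end SymbolsOfWeight

/-! ### The big bracket on even and odd functions. -/

section Poisson

variable {C N : Type*} [CommRing C] [Algebra ℝ C] [AddCommGroup N] [Module C N] [Module ℝ N]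
  [IsScalarTower ℝ C N]

variable (C N) in
/-- Even functions on `T*ΠA`. -/
def IsEven (x : SuperFunctions C N) : Prop :=
  (diffOpFiltration (ExteriorAlgebra C N)).HasParity 0 x

variable (C N) in
/-- Odd functions on `T*ΠA`. -/
def IsOdd (x : SuperFunctions C N) : Prop :=
  (diffOpFiltration (ExteriorAlgebra C N)).HasParity 1 x

variable {x y z : SuperFunctions C N} {k : ℕ} {m : ℤ}

theorem isEven_of_mem (hx : x ∈ symbolsOfWeight C N k m) (hm : Even m) : IsEven C N x :=
  hasParity_of_mem_symbolsOfWeight hx (by simpa using hm)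

theorem isOdd_of_mem (hx : x ∈ symbolsOfWeight C N k m) (hm : Odd m) : IsOdd C N x :=
  hasParity_of_mem_symbolsOfWeight hx (by simpa using hm.add_odd odd_one)

theorem bb_add_left (x y z : SuperFunctions C N) : bb (x + y) z = bb x z + bb y z := by
  simp only [bb, map_add, LinearMap.add_apply]

theorem bb_add_right (x y z : SuperFunctions C N) : bb x (y + z) = bb x y + bb x z := by
  simp only [bb, map_add]

theorem bb_zero_left (x : SuperFunctions C N) : bb 0 x = 0 := by
  simp only [bb, map_zero, LinearMap.zero_apply]

theorem bb_zero_right (x : SuperFunctions C N) : bb x 0 = 0 := by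
  simp only [bb, map_zero]

theorem IsEven.mul_comm {n : ℕ} (hx : IsEven C N x)
    (hy : (diffOpFiltration (ExteriorAlgebra C N)).HasParity n y) : x * y = y * x := by
  simpa using AlmostSuperComm.HasParity.mul_comm hx hy

theorem IsEven.bb_symm {n : ℕ} (hx : IsEven C N x)
    (hy : (diffOpFiltration (ExteriorAlgebra C N)).HasParity n y) : bb x y = -bb y x := by
  simpa [bb] using AlmostSuperComm.HasParity.bracket_symm hx hy

theorem IsOdd.bb_symm (hx : IsOdd C N x) (hy : IsOdd C N y) : bb x y = bb y x := by
  simpa [bb] using AlmostSuperComm.HasParity.bracket_symm hx hy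

theorem IsEven.bb_mul {n l : ℕ} (hx : IsEven C N x)
    (hy : (diffOpFiltration (ExteriorAlgebra C N)).HasParity n y)
    (hz : (diffOpFiltration (ExteriorAlgebra C N)).HasParity l z) :
    bb x (y * z) = bb x y * z + y * bb x z := by
  simpa [bb] using AlmostSuperComm.HasParity.bracket_mul hx hy hz

theorem IsOdd.bb_even_mul {l : ℕ} (hx : IsOdd C N x) (hy : IsEven C N y)
    (hz : (diffOpFiltration (ExteriorAlgebra C N)).HasParity l z) :
    bb x (y * z) = bb x y * z + y * bb x z := by
  simpa [bb] using AlmostSuperComm.HasParity.bracket_mul hx hy hz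

theorem IsOdd.bb_odd_mul {l : ℕ} (hx : IsOdd C N x) (hy : IsOdd C N y)
    (hz : (diffOpFiltration (ExteriorAlgebra C N)).HasParity l z) :
    bb x (y * z) = bb x y * z - y * bb x z := by
  simpa [bb, sub_eq_add_neg] using AlmostSuperComm.HasParity.bracket_mul hx hy hz

theorem IsEven.bb_bb {n l : ℕ} (hx : IsEven C N x)
    (hy : (diffOpFiltration (ExteriorAlgebra C N)).HasParity n y)
    (hz : (diffOpFiltration (ExteriorAlgebra C N)).HasParity l z) :
    bb x (bb y z) = bb (bb x y) z + bb y (bb x z) := by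
  simpa [bb] using AlmostSuperComm.HasParity.bracket_bracket hx hy hz

theorem IsOdd.bb_bb_odd {l : ℕ} (hx : IsOdd C N x) (hy : IsOdd C N y)
    (hz : (diffOpFiltration (ExteriorAlgebra C N)).HasParity l z) :
    bb x (bb y z) = bb (bb x y) z - bb y (bb x z) := by
  simpa [bb, sub_eq_add_neg] using AlmostSuperComm.HasParity.bracket_bracket hx hy hz

end Poisson

/-! ### The pre-Jacobi bracket on functions and sections. -/

section PreJacobi

variable {C N : Type*} [CommRing C] [Algebra ℝ C] [AddCommGroup N] [Module C N] [Module ℝ N]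
  [IsScalarTower ℝ C N]

/-- The bracket of the pre-Jacobi algebroid `μ + φ`. -/
noncomputable def preJacobiBracket (μ : SuperFunctions C N) (φ : N)
    (P Q : SuperFunctions C N) : SuperFunctions C N :=
  bb (bb P (μ + idFun _ _ * ofCovector φ)) Q - P * bb (ofCovector φ) Q + bb P (ofCovector φ) * Q

/-- The differential of the pre-Jacobi algebroid `ν + X` on the dual. -/
noncomputable def preJacobiDifferential (ν : SuperFunctions C N) (X : Module.Dual C N)
    (Q : SuperFunctions C N) : SuperFunctions C N :=
  bb ν Q + ofVector X * Q

variable {μ ν a b : SuperFunctions C N} {φ : N} {X : Module.Dual C N}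

theorem isEven_ofFun (f : C) : IsEven C N (ofFun f) := isEven_of_mem (ofFun_mem f) (by decide)
theorem isOdd_ofCovector (v : N) : IsOdd C N (ofCovector v) :=
  isOdd_of_mem (ofCovector_mem v) (by decide)
theorem isOdd_ofVector (d : Module.Dual C N) : IsOdd C N (ofVector d) :=
  isOdd_of_mem (ofVector_mem d) (by decide)
theorem isEven_idFun : IsEven C N (idFun C N) := isEven_of_mem idFun_mem (by decide)

theorem bb_idFun_ofFun (f : C) : bb (idFun C N) (ofFun f) = 0 := by
  simpa using bb_idFun (ofFun_mem (N := N) f)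

theorem bb_ofFun_idFun (f : C) : bb (ofFun f) (idFun C N) = 0 := by
  rw [(isEven_ofFun f).bb_symm isEven_idFun, bb_idFun_ofFun, neg_zero]

theorem bb_ofCovector_ofFun (v : N) (f : C) : bb (ofCovector v) (ofFun f) = 0 :=
  bb_eq_zero_of_symbolsOfWeight_zero (ofCovector_mem v) (ofFun_mem f)

theorem bb_ofFun_ofCovector (v : N) (f : C) : bb (ofFun f) (ofCovector v) = 0 :=
  bb_eq_zero_of_symbolsOfWeight_zero (ofFun_mem f) (ofCovector_mem v)

theorem bb_ofFun_ofFun (f g : C) : bb (ofFun f : SuperFunctions C N) (ofFun g) = 0 :=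
  bb_eq_zero_of_symbolsOfWeight_zero (ofFun_mem f) (ofFun_mem g)

theorem bb_vector_ofFun (ha : a ∈ symbolsOfWeight C N 1 (-1)) (f : C) : bb a (ofFun f) = 0 :=
  eq_zero_of_mem_symbolsOfWeight
    (bb_mem_symbolsOfWeight (k := 0) ha (ofFun_mem f) rfl) (by decide)

theorem bb_ofFun_vector (ha : a ∈ symbolsOfWeight C N 1 (-1)) (f : C) : bb (ofFun f) a = 0 := by
  rw [(isEven_ofFun f).bb_symm (isOdd_of_mem ha (by decide)), bb_vector_ofFun ha, neg_zero]

theorem bb_vector_vector (ha : a ∈ symbolsOfWeight C N 1 (-1))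
    (hb : b ∈ symbolsOfWeight C N 1 (-1)) : bb a b = 0 :=
  eq_zero_of_mem_symbolsOfWeight (bb_mem_symbolsOfWeight (k := 1) ha hb rfl) (by decide)

theorem bb_vector_ofCovector_mem (ha : a ∈ symbolsOfWeight C N 1 (-1)) (v : N) :
    bb a (ofCovector v) ∈ symbolsOfWeight C N 0 0 :=
  bb_mem_symbolsOfWeight (k := 0) ha (ofCovector_mem v) rfl

theorem bb_vector_idFun (ha : a ∈ symbolsOfWeight C N 1 (-1)) : bb a (idFun C N) = a := by
  rw [← neg_neg (bb a _), ← isEven_idFun.bb_symm (isOdd_of_mem ha (by decide)), bb_idFun ha]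
  simp

theorem bb_ofFun_idFun_mul (f : C) (v : N) :
    bb (ofFun f) (idFun C N * ofCovector v) = 0 := by
  rw [(isEven_ofFun f).bb_mul isEven_idFun (isOdd_ofCovector v), bb_ofFun_idFun,
    bb_ofFun_ofCovector, zero_mul, mul_zero, add_zero]

theorem bb_vector_idFun_mul (ha : a ∈ symbolsOfWeight C N 1 (-1)) (v : N) :
    bb a (idFun C N * ofCovector v) =
      a * ofCovector v + idFun C N * bb a (ofCovector v) := by
  rw [(isOdd_of_mem ha (by decide)).bb_even_mul isEven_idFun (isOdd_ofCovector v),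
    bb_vector_idFun ha]

theorem bb_structure_ofFun_mem (hμ : μ ∈ symbolsOfWeight C N 1 1) (f : C) :
    bb μ (ofFun f) ∈ symbolsOfWeight C N 0 1 :=
  bb_mem_symbolsOfWeight (k := 0) hμ (ofFun_mem f) rfl

theorem bb_vector_structure_mem (hμ : μ ∈ symbolsOfWeight C N 1 1)
    (ha : a ∈ symbolsOfWeight C N 1 (-1)) : bb a μ ∈ symbolsOfWeight C N 1 0 :=
  bb_mem_symbolsOfWeight (k := 1) ha hμ rfl

theorem preJacobiBracket_fun_fun (hμ : μ ∈ symbolsOfWeight C N 1 1) (f g : C) :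
    preJacobiBracket μ φ (ofFun f) (ofFun g) = 0 := by
  have h : bb (ofFun f) μ ∈ symbolsOfWeight C N 0 1 :=
    bb_mem_symbolsOfWeight (k := 0) (ofFun_mem f) hμ rfl
  rw [preJacobiBracket, bb_add_right, bb_ofFun_idFun_mul, add_zero,
    bb_eq_zero_of_symbolsOfWeight_zero h (ofFun_mem g), bb_ofCovector_ofFun, bb_ofFun_ofCovector]
  simp

/-- The term `idFun * ofCovector φ` contributes nothing: its bracket with `a` is built from `a`,
`φ`, `idFun` and a function, all of which commute with functions on the base. -/
theorem preJacobiBracket_vector_fun (ha : a ∈ symbolsOfWeight C N 1 (-1)) (g : C) :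
    preJacobiBracket μ φ a (ofFun g) =
      bb (bb a μ) (ofFun g) + bb a (ofCovector φ) * ofFun g := by
  have hodd := isOdd_of_mem ha (by decide)
  obtain ⟨u, hu⟩ := exists_eq_ofFun (bb_vector_ofCovector_mem ha φ)
  have h1 : bb (a * ofCovector φ) (ofFun g) = 0 := by
    rw [← neg_neg (bb _ _), ← (isEven_ofFun g).bb_symm (hodd.mul (isOdd_ofCovector φ)),
      (isEven_ofFun g).bb_mul hodd (isOdd_ofCovector φ), bb_ofFun_vector ha, bb_ofFun_ofCovector]
    simp
  have h2 : bb (idFun C N * ofFun u) (ofFun g) = 0 := by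
    rw [← neg_neg (bb _ _), ← (isEven_ofFun g).bb_symm (isEven_idFun.mul (isEven_ofFun u)),
      (isEven_ofFun g).bb_mul isEven_idFun (isEven_ofFun u), bb_ofFun_idFun, bb_ofFun_ofFun]
    simp
  rw [preJacobiBracket, bb_add_right, bb_vector_idFun_mul ha, bb_ofCovector_ofFun, bb_add_left,
    bb_add_left, hu, h1, h2]
  simp

theorem bb_bb_vector_structure_ofFun (hμ : μ ∈ symbolsOfWeight C N 1 1)
    (ha : a ∈ symbolsOfWeight C N 1 (-1)) (g : C) :
    bb (bb a μ) (ofFun g) = bb (bb μ (ofFun g)) a := by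
  have hodd := isOdd_of_mem ha (by decide)
  have h := hodd.bb_bb_odd (isOdd_of_mem hμ (by decide)) (isEven_ofFun g)
  rw [bb_vector_ofFun ha, bb_zero_right, sub_zero] at h
  rw [← h, hodd.bb_symm (isOdd_of_mem (bb_structure_ofFun_mem hμ g) (by decide))]

theorem preJacobiBracket_fun_vector (hμ : μ ∈ symbolsOfWeight C N 1 1)
    (ha : a ∈ symbolsOfWeight C N 1 (-1)) (g : C) :
    preJacobiBracket μ φ (ofFun g) a = -preJacobiBracket μ φ a (ofFun g) := by
  have hodd := isOdd_of_mem ha (by decide)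
  rw [preJacobiBracket_vector_fun ha, bb_bb_vector_structure_ofFun hμ ha, preJacobiBracket,
    bb_add_right, bb_ofFun_idFun_mul, bb_ofFun_ofCovector, (isOdd_ofCovector φ).bb_symm hodd,
    (isEven_ofFun g).bb_symm (isOdd_of_mem hμ (by decide)),
    (isEven_ofFun g).mul_comm (isEven_of_mem (bb_vector_ofCovector_mem ha φ) (by decide))]
  simp only [bb, map_neg, LinearMap.neg_apply, add_zero, zero_mul]
  abel

/-- On two sections the contributions a{φ, b} - {a, φ}b of `idFun * ofCovector φ` cancel the two
correction terms of the bracket. -/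
theorem preJacobiBracket_vector_vector (ha : a ∈ symbolsOfWeight C N 1 (-1))
    (hb : b ∈ symbolsOfWeight C N 1 (-1)) :
    preJacobiBracket μ φ a b = bb (bb a μ) b := by
  have hao := isOdd_of_mem ha (by decide)
  have hbo := isOdd_of_mem hb (by decide)
  obtain ⟨u, hu⟩ := exists_eq_ofFun (bb_vector_ofCovector_mem ha φ)
  have h1 : bb (a * ofCovector φ) b = a * bb (ofCovector φ) b := by
    have hev : IsEven C N (a * ofCovector φ) :=
      isEven_of_mem (mul_mem_symbolsOfWeight ha (ofCovector_mem φ)) (by decide)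
    rw [hev.bb_symm hbo, hbo.bb_odd_mul hao (isOdd_ofCovector φ), bb_vector_vector hb ha,
      hbo.bb_symm (isOdd_ofCovector φ)]
    simp
  have h2 : bb (idFun C N * ofFun u) b = -(ofFun u * b) := by
    have hev : IsEven C N (idFun C N * ofFun u) :=
      isEven_of_mem (mul_mem_symbolsOfWeight idFun_mem (ofFun_mem u)) (by decide)
    rw [hev.bb_symm hbo, hbo.bb_even_mul isEven_idFun (isEven_ofFun u), bb_vector_idFun hb,
      bb_vector_ofFun hb, (isEven_ofFun u).mul_comm hbo]
    simp
  rw [preJacobiBracket, bb_add_right, bb_vector_idFun_mul ha, bb_add_left, bb_add_left, hu, h1, h2]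
  abel

theorem smul_two_eq_zero {V : Type*} [AddCommGroup V] [Module ℝ V] {v : V} (h : v + v = 0) :
    v = 0 := by
  rw [← two_smul ℝ, smul_eq_zero] at h
  exact h.resolve_left two_ne_zero

/-- The bracket on sections acts on functions as the commutator. -/
theorem preJacobiBracket_jacobi (hμ : μ ∈ symbolsOfWeight C N 1 1) (hμμ : bb μ μ = 0)
    (hμφ : bb μ (ofCovector φ) = 0) (ha : a ∈ symbolsOfWeight C N 1 (-1))
    (hb : b ∈ symbolsOfWeight C N 1 (-1)) (g : C) :
    preJacobiBracket μ φ (preJacobiBracket μ φ a b) (ofFun g) =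
      preJacobiBracket μ φ a (preJacobiBracket μ φ b (ofFun g)) -
        preJacobiBracket μ φ b (preJacobiBracket μ φ a (ofFun g)) := by
  have hμo := isOdd_of_mem hμ (by decide)
  have hao := isOdd_of_mem ha (by decide)
  have hbo := isOdd_of_mem hb (by decide)
  have hAmem := bb_vector_structure_mem hμ ha
  have hBmem := bb_vector_structure_mem hμ hb
  have hA := isEven_of_mem hAmem (by decide)
  have hB := isEven_of_mem hBmem (by decide)
  -- Bracketing {μ, μ} = 0 with `a` gives twice {{a, μ}, μ}.
  have hAμ : bb (bb a μ) μ = 0 := by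
    have h := hao.bb_bb_odd hμo hμo
    rw [hμμ, bb_zero_right, ← neg_neg (bb μ (bb a μ)), ← hA.bb_symm hμo, sub_neg_eq_add] at h
    exact smul_two_eq_zero h.symm
  have hanchor : ∀ {c : SuperFunctions C N}, c ∈ symbolsOfWeight C N 1 (-1) →
      bb (bb c μ) (ofCovector φ) = bb μ (bb c (ofCovector φ)) := by
    intro c hc
    have h := (isOdd_of_mem hc (by decide)).bb_bb_odd hμo (isOdd_ofCovector φ)
    rw [hμφ, bb_zero_right] at h
    exact sub_eq_zero.mp h.symm
  have hab : bb (bb a μ) b ∈ symbolsOfWeight C N 1 (-1) :=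
    bb_mem_symbolsOfWeight (k := 1) hAmem hb rfl
  have habo := isOdd_of_mem hab (by decide)
  obtain ⟨u, hu⟩ := exists_eq_ofFun (bb_vector_ofCovector_mem ha φ)
  obtain ⟨v, hv⟩ := exists_eq_ofFun (bb_vector_ofCovector_mem hb φ)
  obtain ⟨p, hp⟩ := exists_eq_ofFun
    (bb_mem_symbolsOfWeight (k := 0) hAmem (ofFun_mem g) rfl)
  obtain ⟨q, hq⟩ := exists_eq_ofFun
    (bb_mem_symbolsOfWeight (k := 0) hBmem (ofFun_mem g) rfl)
  -- The derivation parts: {{a, μ}, ·} is compatible with the brackets of sections.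
  have hcomm : bb (bb (bb (bb a μ) b) μ) (ofFun g) =
      bb (bb a μ) (bb (bb b μ) (ofFun g)) - bb (bb b μ) (bb (bb a μ) (ofFun g)) := by
    have h1 := hA.bb_bb hbo hμo
    rw [hAμ, bb_zero_right, add_zero] at h1
    rw [← h1, hA.bb_bb hB (isEven_ofFun g), add_sub_cancel_right]
  -- The zeroth-order parts: {·, φ} is a cocycle. Together with `hcomm` this is the commutator of
  -- the first-order operators A + u and B + v.
  have hφ : bb (bb (bb a μ) b) (ofCovector φ) =
      bb (bb a μ) (ofFun v) - bb (bb b μ) (ofFun u) := by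
    have h1 := hA.bb_bb hbo (isOdd_ofCovector φ)
    have h2 := hbo.bb_bb_odd hμo (isEven_ofFun u)
    rw [bb_vector_ofFun hb, bb_zero_right, sub_zero] at h2
    rw [hanchor ha, hu, hv, h2] at h1
    rw [h1, add_sub_cancel_right]
  rw [preJacobiBracket_vector_vector ha hb, preJacobiBracket_vector_fun hab,
    preJacobiBracket_vector_fun ha, preJacobiBracket_vector_fun hb, hcomm, hφ, hu, hv, hp, hq,
    ← ofFun_mul, ← ofFun_mul, ← ofFun_add, ← ofFun_add, preJacobiBracket_vector_fun ha,
    preJacobiBracket_vector_fun hb, hu, hv, ofFun_add, ofFun_add, bb_add_right, bb_add_right,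
    ofFun_mul, ofFun_mul, hA.bb_mul (isEven_ofFun v) (isEven_ofFun g),
    hB.bb_mul (isEven_ofFun u) (isEven_ofFun g), hp, hq, sub_mul, mul_add, mul_add,
    ← mul_assoc, ← mul_assoc, (isEven_ofFun u).mul_comm (isEven_ofFun v)]
  abel

theorem preJacobiDifferential_fun_mem (hν : ν ∈ symbolsOfWeight C N 2 (-1)) (f : C) :
    preJacobiDifferential ν X (ofFun f) ∈ symbolsOfWeight C N 1 (-1) :=
  add_mem_symbolsOfWeight
    (by simpa using bb_mem_symbolsOfWeight (k := 1) hν (ofFun_mem f) rfl)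
    (by simpa using mul_mem_symbolsOfWeight (ofVector_mem X) (ofFun_mem f))

/-- The four terms are P(g, f), f Z(g), g W(f) and c f g in the notation above; comparison with the
same formula for f and g exchanged determines W and c. -/
theorem preJacobiBracket_differential_fun (hμ : μ ∈ symbolsOfWeight C N 1 1)
    (hν : ν ∈ symbolsOfWeight C N 2 (-1)) (f g : C) :
    preJacobiBracket μ φ (preJacobiDifferential ν X (ofFun f)) (ofFun g) =
      bb (bb μ (ofFun g)) (bb ν (ofFun f)) + bb (bb μ (ofFun g)) (ofVector X) * ofFun f +
        (bb (bb ν (ofFun f)) (ofCovector φ) + bb (ofVector X) (ofCovector φ) * ofFun f) *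
          ofFun g := by
  have hg : IsOdd C N (bb μ (ofFun g)) := isOdd_of_mem (bb_structure_ofFun_mem hμ g) (by decide)
  have hX := isOdd_ofVector X
  have hφ := isOdd_ofCovector (C := C) φ
  have h0 : bb (bb μ (ofFun g)) (ofFun f) = 0 :=
    bb_eq_zero_of_symbolsOfWeight_zero (bb_structure_ofFun_mem hμ g) (ofFun_mem f)
  have hXf : IsOdd C N (ofVector X * ofFun f) :=
    isOdd_of_mem (mul_mem_symbolsOfWeight (ofVector_mem X) (ofFun_mem f)) (by decide)
  have h1 : bb (ofVector X * ofFun f) (ofCovector φ) =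
      bb (ofVector X) (ofCovector φ) * ofFun f := by
    rw [hXf.bb_symm hφ, hφ.bb_odd_mul hX (isEven_ofFun f), bb_ofCovector_ofFun, hφ.bb_symm hX]
    simp
  rw [preJacobiBracket_vector_fun (preJacobiDifferential_fun_mem hν f),
    bb_bb_vector_structure_ofFun hμ (preJacobiDifferential_fun_mem hν f), preJacobiDifferential,
    bb_add_right, bb_add_left, hg.bb_odd_mul hX (isEven_ofFun f), h0, h1]
  simp

end PreJacobi

/-! ### From the Jacobi identity on functions to a Jacobi structure. -/

section JacobiIdentities

variable {C : Type*} [CommRing C] [Algebra ℝ C] {P : C → Derivation ℝ C C} {Z : Derivation ℝ C C}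

/-- The bracket of functions defined by a biderivation and a derivation. -/
def functionBracket (P : C → Derivation ℝ C C) (Z : Derivation ℝ C C) (f g : C) : C :=
  P f g + g * Z f - f * Z g

/-- Since the bracket of `1` with `f` is `-Z f`, the Jacobi identity at `h = 1` makes `Z` a
derivation of the bracket; the terms containing only `Z` cancel. -/
theorem schoutenVectorBivector_eq_zero (hP : ∀ f g, P f g = -P g f)
    (hK : ∀ f g h, -functionBracket P Z h (functionBracket P Z f g) =
      functionBracket P Z (functionBracket P Z h g) f -
        functionBracket P Z (functionBracket P Z h f) g) (f g : C) :
    Z (P f g) = P (Z f) g + P f (Z g) := by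
  have h1 : ∀ g, P 1 g = 0 := fun g => by rw [hP, Derivation.map_one_eq_zero, neg_zero]
  have h := hK f g 1
  simp only [functionBracket, h1, map_add, map_sub, Derivation.leibniz, smul_eq_mul, map_neg,
    Derivation.map_one_eq_zero, mul_zero, zero_sub, one_mul, add_zero, mul_neg, neg_mul] at h
  have h2 := hP (-Z g) f
  have h3 := hP (-Z f) g
  have h4 := hP f (Z g)
  rw [map_neg] at h2 h3
  linear_combination h + h2 - h3 - hP (Z f) g

/-- After the Leibniz rule and the invariance of `P` under `Z`, only the two cyclic sums survive in
the Jacobi identity. -/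
theorem schoutenBivector_eq (hP : ∀ f g, P f g = -P g f)
    (hK : ∀ f g h, -functionBracket P Z h (functionBracket P Z f g) =
      functionBracket P Z (functionBracket P Z h g) f -
        functionBracket P Z (functionBracket P Z h f) g) (f g h : C) :
    P f (P g h) + P g (P h f) + P h (P f g) = Z f * P g h + Z g * P h f + Z h * P f g := by
  have hL := schoutenVectorBivector_eq_zero hP hK
  have hPZ : ∀ a b, P (Z a) b = -P b (Z a) := fun a b => hP _ _
  have h0 := hK f g h
  simp only [functionBracket] at h0
  rw [hP (P h g + g * Z h - h * Z g) f, hP (P h f + f * Z h - h * Z f) g] at h0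
  simp only [map_add, map_sub, Derivation.leibniz, smul_eq_mul, hL, hPZ, hP g f, hP h g, hP f h,
    map_neg] at h0 ⊢
  linear_combination -h0

end JacobiIdentities

/-! ### Derivations of the base algebra coming from symbols. -/

section Derivations

variable {C N : Type*} [CommRing C] [Algebra ℝ C] [AddCommGroup N] [Module C N] [Module ℝ N]
  [IsScalarTower ℝ C N]

theorem ofFun_smul (c : ℝ) (f : C) :
    (ofFun (c • f) : SuperFunctions C N) = c • (ofFun f : SuperFunctions C N) := by
  have h : (c • ofFun f : SuperFunctions C N) = _ :=
    AlmostSuperComm.symbol_smul (D := diffOpFiltration (ExteriorAlgebra C N)) (k := 0) c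
      (mulLeft_mem (algebraMap C (ExteriorAlgebra C N) f))
  rw [h]
  refine AlmostSuperComm.symbol_congr (D := diffOpFiltration (ExteriorAlgebra C N)) ?_
    (mulLeft_mem _) _
  ext
  rw [Algebra.algebraMap_eq_smul_one, Algebra.algebraMap_eq_smul_one]
  simp

/-- Order one and weight zero send functions to functions, and the bracket with an even element
obeys the unsigned Leibniz rule. -/
theorem exists_derivation {A : SuperFunctions C N} (hA : A ∈ symbolsOfWeight C N 1 0) :
    ∃ Z : Derivation ℝ C C, ∀ f, bb A (ofFun f) = ofFun (Z f) := by
  choose Z hZ using fun f : C => exists_eq_ofFun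
    (bb_mem_symbolsOfWeight (k := 0) hA (ofFun_mem f) rfl)
  refine ⟨Derivation.mk' ⟨⟨Z, fun f g => ofFun_injective (N := N) ?_⟩, fun c f =>
    ofFun_injective (N := N) ?_⟩ fun f g => ofFun_injective (N := N) ?_, hZ⟩
  · rw [← hZ, ofFun_add, ofFun_add, bb_add_right, hZ, hZ]
  · rw [RingHom.id_apply]
    change ofFun (Z (c • f)) = ofFun (c • Z f)
    rw [← hZ, ofFun_smul, ofFun_smul, ← hZ, bb, map_smul]
    rfl
  · change ofFun (Z (f * g)) = ofFun (f * Z g + g * Z f)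
    rw [← hZ, ofFun_mul, (isEven_of_mem hA (by decide)).bb_mul (isEven_ofFun f) (isEven_ofFun g),
      hZ, hZ, ← ofFun_mul, ← ofFun_mul, ← ofFun_add, mul_comm (Z f), add_comm]

theorem bb_ofFun_one {A : SuperFunctions C N} (hA : IsOdd C N A) : bb A (ofFun 1) = 0 := by
  have h := hA.bb_even_mul (isEven_ofFun 1) (isEven_ofFun 1)
  rw [← ofFun_mul, mul_one, ofFun_one, mul_one, one_mul] at h
  rw [ofFun_one]
  simpa using h

end Derivations

/-! ### Consequences of compatibility in low degree. -/

section Bialgebroid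

variable {C N : Type*} [CommRing C] [Algebra ℝ C] [AddCommGroup N] [Module C N] [Module ℝ N]
  [IsScalarTower ℝ C N] {μ ν : SuperFunctions C N} {φ : N} {X : Module.Dual C N}

/-- The hypotheses `hcompat` and `hcompat'` are the compatibility of a function with a function and
with a differential, after [f, g] = 0 and d² = 0 have been used. -/
theorem exists_derivation_biderivation (hμ : μ ∈ symbolsOfWeight C N 1 1)
    (hν : ν ∈ symbolsOfWeight C N 2 (-1)) (hμμ : bb μ μ = 0) (hμφ : bb μ (ofCovector φ) = 0)
    (hcompat : ∀ f g, preJacobiBracket μ φ (preJacobiDifferential ν X (ofFun f)) (ofFun g) =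
      preJacobiBracket μ φ (ofFun f) (preJacobiDifferential ν X (ofFun g)))
    (hcompat' : ∀ f g, preJacobiDifferential ν X
        (preJacobiBracket μ φ (ofFun f) (preJacobiDifferential ν X (ofFun g))) =
      preJacobiBracket μ φ (preJacobiDifferential ν X (ofFun f))
        (preJacobiDifferential ν X (ofFun g))) :
    ∃ (Z : Derivation ℝ C C) (P : C → Derivation ℝ C C),
      (∀ f, bb (bb μ (ofVector X)) (ofFun f) = ofFun (Z f)) ∧
      (∀ f, -bb (bb ν (ofCovector φ)) (ofFun f) = ofFun (Z f)) ∧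
      (∀ f g, bb (bb μ (ofFun f)) (bb ν (ofFun g)) = ofFun (P f g)) ∧
      (∀ f g, P f g = -P g f) ∧
      (∀ f g, Z (P f g) = P (Z f) g + P f (Z g)) ∧
      ∀ f g h, P f (P g h) + P g (P h f) + P h (P f g) =
        Z f * P g h + Z g * P h f + Z h * P f g := by
  have hμo := isOdd_of_mem hμ (by decide)
  have hνo := isOdd_of_mem hν (by decide)
  have hXo := isOdd_ofVector X
  have hφo := isOdd_ofCovector (C := C) φ
  obtain ⟨Z, hZ⟩ := exists_derivation
    (by simpa using bb_mem_symbolsOfWeight (k := 1) hμ (ofVector_mem X) rfl)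
  obtain ⟨W, hW⟩ := exists_derivation
    (by simpa using bb_mem_symbolsOfWeight (k := 1) hν (ofCovector_mem φ) rfl)
  -- {{μ, f}, ν} gives a derivation in the second argument; it equals {{μ, f}, {ν, ·}} because {{μ,
  -- f}, g} = 0. The derivation property in `f` only comes with skewness.
  choose P hP' using fun f : C => exists_derivation (by
    simpa using bb_mem_symbolsOfWeight (k := 1) (bb_structure_ofFun_mem hμ f) hν rfl)
  have hP : ∀ f g, bb (bb μ (ofFun f)) (bb ν (ofFun g)) = ofFun (P f g) := fun f g => by
    rw [← hP', (isOdd_of_mem (bb_structure_ofFun_mem hμ f) (by decide)).bb_bb_odd hνo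
      (isEven_ofFun g), bb_eq_zero_of_symbolsOfWeight_zero (bb_structure_ofFun_mem hμ f)
      (ofFun_mem g), bb_zero_right, sub_zero]
  have hZ' : ∀ g, bb (bb μ (ofFun g)) (ofVector X) = ofFun (Z g) := fun g => by
    rw [← bb_bb_vector_structure_ofFun hμ (ofVector_mem X), hXo.bb_symm hμo, hZ]
  have hW' : ∀ f, bb (bb ν (ofFun f)) (ofCovector φ) = ofFun (W f) := fun f => by
    have h := hφo.bb_bb_odd hνo (isEven_ofFun f)
    rw [bb_ofCovector_ofFun, bb_zero_right, sub_zero, hφo.bb_symm hνo, hW] at h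
    rw [← h, hφo.bb_symm (isOdd_of_mem
      (bb_mem_symbolsOfWeight (k := 1) hν (ofFun_mem f) rfl) (by decide))]
  obtain ⟨c, hc⟩ := exists_eq_ofFun (bb_vector_ofCovector_mem (ofVector_mem X) φ)
  have hJ : ∀ f g, preJacobiBracket μ φ (preJacobiDifferential ν X (ofFun f)) (ofFun g) =
      ofFun (P g f + Z g * f + (W f + c * f) * g) := fun f g => by
    rw [preJacobiBracket_differential_fun hμ hν, hP, hZ', hW', hc]
    simp only [ofFun_add, ofFun_mul]
  have hD : ∀ f, preJacobiDifferential ν X (ofFun f) ∈ symbolsOfWeight C N 1 (-1) :=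
    preJacobiDifferential_fun_mem hν
  have hsym : ∀ f g, P g f + Z g * f + (W f + c * f) * g +
      (P f g + Z f * g + (W g + c * g) * f) = 0 := fun f g => by
    apply ofFun_injective (N := N)
    rw [ofFun_add, ← hJ, ← hJ, hcompat, preJacobiBracket_fun_vector hμ (hD g), neg_add_cancel]
    exact ((ofFunHom C N).map_zero).symm
  have hP1 : ∀ g, P 1 g = 0 := fun g => by
    apply ofFun_injective (N := N)
    rw [← hP, bb_ofFun_one hμo, bb_zero_left]
    exact ((ofFunHom C N).map_zero).symm
  -- At f = g = 1 every derivation term disappears and 2c = 0 remains; f = 1 next relates `W` to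
  -- `Z`.
  have hc0 : c = 0 := by
    have := hsym 1 1
    simp only [Derivation.map_one_eq_zero, mul_one, zero_add] at this
    exact smul_two_eq_zero this
  have hZW : ∀ g, W g = -Z g := fun g => by
    have := hsym 1 g
    simp only [Derivation.map_one_eq_zero, mul_one, zero_mul, zero_add, hc0, hP1, add_zero] at this
    linear_combination this
  have hskew : ∀ f g, P f g = -P g f := fun f g => by
    have := hsym f g
    rw [hc0, hZW, hZW] at this
    linear_combination this
  have hK : ∀ f g, preJacobiBracket μ φ (preJacobiDifferential ν X (ofFun f)) (ofFun g) =
      ofFun (functionBracket P Z g f) := fun f g => by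
    rw [hJ, hc0, hZW, functionBracket]
    congr 1
    ring
  have hKjac : ∀ f g h, -functionBracket P Z h (functionBracket P Z f g) =
      functionBracket P Z (functionBracket P Z h g) f -
        functionBracket P Z (functionBracket P Z h f) g := fun f g h => by
    -- On the left, [df, dg] is replaced by d[f, dg] = -dK(f, g), with K the `functionBracket`.
    have h1 := preJacobiBracket_jacobi hμ hμμ hμφ (hD f) (hD g) h
    rw [← hcompat', preJacobiBracket_fun_vector hμ (hD g), hK, hK, hK, hK, hK] at h1
    have hneg : ∀ u : C, -(ofFun u : SuperFunctions C N) = ofFun (-u) := fun u =>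
      ((ofFunHom C N).map_neg u).symm
    have hsub : ∀ u v : C, (ofFun u : SuperFunctions C N) - ofFun v = ofFun (u - v) := fun u v =>
      ((ofFunHom C N).map_sub u v).symm
    rw [hneg, hK, hsub] at h1
    rw [← ofFun_injective h1]
    simp only [functionBracket, map_neg]
    ring
  exact ⟨Z, P, hZ, fun f => by
    rw [hW, hZW]
    exact ((congrArg _ ((ofFunHom C N).map_neg _)).trans (neg_neg _)), hP, hskew,
    schoutenVectorBivector_eq_zero hskew hKjac, schoutenBivector_eq hskew hKjac⟩

end Bialgebroid

/-! ### Smooth sections in coordinates. -/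

section Sections

open Filter Topology

variable {E : Type*} [NormedAddCommGroup E] [NormedSpace ℝ E]
  {M : Type*} [TopologicalSpace M] [ChartedSpace E M]
  {F : Type*} [NormedAddCommGroup F] [NormedSpace ℝ F] {W : M → Type*}
  [TopologicalSpace (Bundle.TotalSpace F W)] [∀ x, TopologicalSpace (W x)] [FiberBundle F W]

theorem contMDiffAt_section_of_coordinates [FiniteDimensional ℝ F] {x₀ : M} {s : ∀ x, W x}
    (hs : ∀ L : F →L[ℝ] ℝ, ContMDiffAt 𝓘(ℝ, E) 𝓘(ℝ, ℝ) ∞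
      (fun x => L (trivializationAt F W x₀ ⟨x, s x⟩).2) x₀) :
    ContMDiffAt 𝓘(ℝ, E) (𝓘(ℝ, E).prod 𝓘(ℝ, F)) ∞
      (fun x => Bundle.TotalSpace.mk' F x (s x)) x₀ := by
  rw [Bundle.contMDiffAt_section]
  let b := Module.finBasis ℝ F
  have h : ∀ x, (trivializationAt F W x₀ ⟨x, s x⟩).2 =
      ∑ i, (b.coord i).toContinuousLinearMap (trivializationAt F W x₀ ⟨x, s x⟩).2 • b i :=
    fun x => (b.sum_repr _).symm
  refine ContMDiffAt.congr_of_eventuallyEq ?_ (Eventually.of_forall h)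
  exact ContMDiffAt.sum fun i _ => (hs _).smul contMDiffAt_const

theorem function_sum_apply {ι : Type*} (t : Finset ι) (f : ι → C^∞⟮𝓘(ℝ, E), M; ℝ⟯) (x : M) :
    (∑ i ∈ t, f i) x = ∑ i ∈ t, f i x :=
  map_sum (⟨⟨fun f => f x, rfl⟩, fun _ _ => rfl⟩ : C^∞⟮𝓘(ℝ, E), M; ℝ⟯ →+ ℝ) f t

variable [∀ x, AddCommGroup (W x)] [∀ x, Module ℝ (W x)] [VectorBundle ℝ F W]

theorem section_sum_apply {ι : Type*} (t : Finset ι) (s : ι → Cₛ^∞⟮𝓘(ℝ, E); F, W⟯) (x : M) :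
    (∑ i ∈ t, s i) x = ∑ i ∈ t, s i x :=
  map_sum (⟨⟨fun s => s x, rfl⟩, fun _ _ => rfl⟩ : Cₛ^∞⟮𝓘(ℝ, E); F, W⟯ →+ W x) s t

end Sections

/-! ### Extension of germs and tensoriality. -/

section SmoothExtension

open Filter Topology

variable {E : Type*} [NormedAddCommGroup E] [NormedSpace ℝ E] [FiniteDimensional ℝ E]
  {M : Type*} [TopologicalSpace M] [ChartedSpace E M] [IsManifold 𝓘(ℝ, E) ∞ M] [T2Space M]

theorem exists_smooth_bump {x₀ : M} {u : Set M} (hu : u ∈ 𝓝 x₀) :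
    ∃ ρ : C^∞⟮𝓘(ℝ, E), M; ℝ⟯, tsupport ρ ⊆ u ∧ ∀ᶠ x in 𝓝 x₀, ρ x = 1 := by
  obtain ⟨ρ, -, hρ⟩ := (SmoothBumpFunction.nhds_basis_tsupport (I := 𝓘(ℝ, E)) x₀).mem_iff.mp hu
  exact ⟨⟨ρ, ρ.contMDiff⟩, hρ, ρ.eventuallyEq_one⟩

theorem exists_smooth_extension {x₀ : M} {u : Set M} (hu : IsOpen u) (hx : x₀ ∈ u) {f : M → ℝ}
    (hf : ContMDiffOn 𝓘(ℝ, E) 𝓘(ℝ, ℝ) ∞ f u) :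
    ∃ g : C^∞⟮𝓘(ℝ, E), M; ℝ⟯, ∀ᶠ x in 𝓝 x₀, g x = f x := by
  obtain ⟨ρ, hρ, h1⟩ := exists_smooth_bump (E := E) (hu.mem_nhds hx)
  refine ⟨⟨fun x => ρ x * f x, contMDiff_of_tsupport fun x hx => ?_⟩, ?_⟩
  · have hxu : x ∈ u := hρ (closure_mono (Function.support_mul_subset_left _ _) hx)
    exact (ρ.contMDiff x).mul (hf.contMDiffAt (hu.mem_nhds hxu))
  · filter_upwards [h1] with x hx
    change ρ x * f x = f x
    rw [hx, one_mul]

variable {F : Type*} [NormedAddCommGroup F] [NormedSpace ℝ F] {W : M → Type*}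
  [TopologicalSpace (Bundle.TotalSpace F W)] [∀ x, AddCommGroup (W x)] [∀ x, Module ℝ (W x)]
  [∀ x, TopologicalSpace (W x)] [FiberBundle F W] [VectorBundle ℝ F W]

theorem exists_section_extension {x₀ : M} {u : Set M} (hu : IsOpen u) (hx : x₀ ∈ u)
    {s : ∀ x, W x} (hs : ContMDiffOn 𝓘(ℝ, E) (𝓘(ℝ, E).prod 𝓘(ℝ, F)) ∞
      (fun x => Bundle.TotalSpace.mk' F x (s x)) u) :
    ∃ t : Cₛ^∞⟮𝓘(ℝ, E); F, W⟯, ∀ᶠ x in 𝓝 x₀, t x = s x := by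
  obtain ⟨ρ, hρ, h1⟩ := exists_smooth_bump (E := E) (hu.mem_nhds hx)
  refine ⟨⟨_, ContMDiffOn.smul_section_of_tsupport ρ.contMDiff.contMDiffOn hu hρ hs⟩, ?_⟩
  filter_upwards [h1] with x hx
  change ρ x • s x = s x
  rw [hx, one_smul]

variable [FiniteDimensional ℝ F] [ContMDiffVectorBundle ∞ F W 𝓘(ℝ, E)]

/-- A linear form on the sections of a vector bundle is given by a family of linear forms on the
fibres. -/
theorem dual_section_apply_eq_zero
    (d : Module.Dual C^∞⟮𝓘(ℝ, E), M; ℝ⟯ Cₛ^∞⟮𝓘(ℝ, E); F, W⟯) {ξ : Cₛ^∞⟮𝓘(ℝ, E); F, W⟯} {x : M}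
    (hξ : ξ x = 0) : d ξ x = 0 := by
  -- Locality: a bump function equal to 1 near `x` and supported where `η` vanishes annihilates `η`.
  have hlocal : ∀ η : Cₛ^∞⟮𝓘(ℝ, E); F, W⟯, (∀ᶠ y in 𝓝 x, η y = 0) → d η x = 0 := by
    intro η hη
    obtain ⟨ρ, hρ, h1⟩ := exists_smooth_bump (E := E) hη
    have h0 : ρ • η = 0 := by
      ext y
      change ρ y • η y = 0
      by_cases hy : y ∈ tsupport ρ
      · rw [hρ hy, smul_zero]
      · rw [image_eq_zero_of_notMem_tsupport hy, zero_smul]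
    have h2 : (ρ • d η) x = 0 := by rw [← map_smul, h0, map_zero]; rfl
    have h3 : ρ x * d η x = 0 := h2
    rwa [h1.self_of_nhds, one_mul] at h3
  let e := trivializationAt F W x
  let b := Module.finBasis ℝ F
  have hx : x ∈ e.baseSet := FiberBundle.mem_baseSet_trivializationAt' x
  choose c hc using fun i => exists_smooth_extension e.open_baseSet hx
    (contMDiffOn_baseSet_localFrameCoeff (e := e) b ξ.contMDiff.contMDiffOn i)
  choose s hs using fun i => exists_section_extension e.open_baseSet hx
    (e.contMDiffOn_localFrame_baseSet (I := 𝓘(ℝ, E)) ∞ b i)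
  -- Near `x` the section is the combination of globalised frame sections `s i` with globalised
  -- coefficients `c i`, and these coefficients vanish at `x`.
  have h0 : d (ξ - ∑ i, c i • s i) x = 0 := by
    refine hlocal _ ?_
    filter_upwards [eventually_all.mpr hc, eventually_all.mpr hs,
      e.open_baseSet.mem_nhds hx] with y hcy hsy hy
    rw [ContMDiffSection.coe_sub, Pi.sub_apply, section_sum_apply, sub_eq_zero]
    refine (e.eq_sum_localFrameCoeff_smul (I := 𝓘(ℝ, E)) (b := b) (s := ξ) hy).trans
      (Finset.sum_congr rfl fun i _ => ?_)
    change _ = c i y • s i y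
    rw [hcy, hsy]
    rfl
  have hc0 : ∀ i, c i x = 0 := fun i => by
    rw [(hc i).self_of_nhds]
    change e.localFrameCoeff 𝓘(ℝ, E) b i x (ξ x) = 0
    rw [hξ, map_zero]
  rw [map_sub, map_sum] at h0
  simp only [map_smul] at h0
  have h1 : d ξ x - (∑ i, c i • d (s i)) x = 0 := h0
  rw [function_sum_apply, Finset.sum_eq_zero, sub_zero] at h1
  · exact h1
  · intro i _
    change c i x * _ = 0
    rw [hc0, zero_mul]

end SmoothExtension

/-! ### Sections of a bundle as linear forms on dual sections. -/

section DualSections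

open Filter Topology

variable {E : Type*} [NormedAddCommGroup E] [NormedSpace ℝ E] [FiniteDimensional ℝ E]
  {M : Type*} [TopologicalSpace M] [ChartedSpace E M] [IsManifold 𝓘(ℝ, E) ∞ M] [T2Space M]
  {F : Type*} [NormedAddCommGroup F] [NormedSpace ℝ F]
  {V : M → Type*} [TopologicalSpace (Bundle.TotalSpace F V)]
  [∀ x, AddCommGroup (V x)] [∀ x, Module ℝ (V x)] [∀ x, TopologicalSpace (V x)]
  [FiberBundle F V] [VectorBundle ℝ F V] [ContMDiffVectorBundle ∞ F V 𝓘(ℝ, E)]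

/-- The form that is constantly `L` in the trivialization at `x₀`, cut off away from `x₀`. Pairing
with it reads off one coordinate of a section. -/
theorem exists_dualSection (x₀ : M) (L : F →L[ℝ] ℝ) :
    ∃ η : DualSection E F V, ∀ᶠ x in 𝓝 x₀, ∀ v : V x,
      η x v = L (trivializationAt F V x₀ ⟨x, v⟩).2 := by
  let e := trivializationAt F V x₀
  have hx : x₀ ∈ e.baseSet := FiberBundle.mem_baseSet_trivializationAt' x₀
  have hs : ContMDiffOn 𝓘(ℝ, E) (𝓘(ℝ, E).prod 𝓘(ℝ, F →L[ℝ] ℝ)) ∞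
      (fun x => Bundle.TotalSpace.mk' (F →L[ℝ] ℝ) (E := fun x => V x →L[ℝ] ℝ) x
        (L.comp (e.continuousLinearMapAt ℝ x))) e.baseSet := by
    let e' := trivializationAt (F →L[ℝ] ℝ) (fun x => V x →L[ℝ] ℝ) x₀
    have he' : e'.baseSet = e.baseSet := by
      rw [hom_trivializationAt_baseSet]
      exact Set.inter_univ _
    rw [← he']
    refine (e'.contMDiffOn_section_baseSet_iff).mpr ?_
    refine (contMDiffOn_const (c := L)).congr fun y hy => ?_
    rw [he'] at hy
    rw [hom_trivializationAt_apply]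
    ext v
    have h1 : e.continuousLinearMapAt ℝ y (e.symmL ℝ y v) = v := e.continuousLinearMapAt_symmL hy v
    refine Eq.trans ?_ (congrArg L h1)
    simp only [ContinuousLinearMap.inCoordinates, ContinuousLinearMap.comp_apply]
    exact congrArg (fun T : ℝ →L[ℝ] ℝ => T _)
      (Bundle.Trivial.continuousLinearMapAt_trivialization ℝ M ℝ y)
  obtain ⟨η, hη⟩ := exists_section_extension e.open_baseSet hx hs
  refine ⟨η, ?_⟩
  filter_upwards [hη, e.open_baseSet.mem_nhds hx] with x hηx hxe v
  rw [hηx, ContinuousLinearMap.comp_apply]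
  congr 1
  exact e.coe_linearMapAt_of_mem (R := ℝ) hxe ▸ rfl

variable [FiniteDimensional ℝ F]

/-- Sections of a vector bundle of finite rank are the linear forms on the sections of its dual. -/
theorem pairing_surjective :
    Function.Surjective (pairing : Cₛ^∞⟮𝓘(ℝ, E); F, V⟯ → _) := by
  intro d
  let b := Module.finBasis ℝ F
  have hpt : ∀ x : M, ∃ v : V x, ∀ ξ : DualSection E F V, d ξ x = ξ x v := by
    intro x
    let e := trivializationAt F V x
    have hx : x ∈ e.baseSet := FiberBundle.mem_baseSet_trivializationAt' x
    choose η hη using fun i => exists_dualSection (E := E) (V := V) x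
      (b.coord i).toContinuousLinearMap
    refine ⟨∑ i, d (η i) x • e.symm x (b i), fun ξ => ?_⟩
    have hcoord : ∀ i (v : V x), η i x v = b.coord i (e ⟨x, v⟩).2 := fun i v =>
      (hη i).self_of_nhds v
    -- Only values at `x` matter, by `dual_section_apply_eq_zero`, so constant coefficients suffice.
    let c : _ → C^∞⟮𝓘(ℝ, E), M; ℝ⟯ := fun i => algebraMap ℝ _ (ξ x (e.symm x (b i)))
    have hξ : (ξ - ∑ i, c i • η i) x = 0 := by
      rw [ContMDiffSection.coe_sub, Pi.sub_apply, section_sum_apply, sub_eq_zero]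
      ext v
      have hv : v = ∑ i, b.coord i (e ⟨x, v⟩).2 • e.symm x (b i) := by
        have h1 : (e.symmL ℝ x) (∑ i, b.coord i (e ⟨x, v⟩).2 • b i) = v := by
          have h2 : ∑ i, b.coord i (e ⟨x, v⟩).2 • b i = (e ⟨x, v⟩).2 := b.sum_repr _
          rw [h2]
          exact (e.symmL_apply hx _).trans (e.symm_apply_apply_mk hx v)
        rw [map_sum] at h1
        simp only [map_smul] at h1
        simpa only [e.symmL_apply hx] using h1.symm
      rw [_root_.sum_apply]
      conv_lhs => rw [hv, map_sum]
      refine Finset.sum_congr rfl fun i _ => ?_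
      change _ = ξ x (e.symm x (b i)) * η i x v
      rw [map_smul, hcoord, smul_eq_mul, mul_comm]
    have h0 := dual_section_apply_eq_zero d hξ
    rw [map_sub, map_sum] at h0
    simp only [map_smul] at h0
    have h1 : d ξ x - (∑ i, c i • d (η i)) x = 0 := h0
    rw [sub_eq_zero.mp h1, function_sum_apply, map_sum]
    refine Finset.sum_congr rfl fun i _ => ?_
    change ξ x (e.symm x (b i)) * d (η i) x = _
    rw [map_smul, smul_eq_mul, mul_comm]
  choose a ha using hpt
  -- Near `x₀` the `L`-coordinate of the pointwise solution `a` is the smooth function `d η`.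
  refine ⟨⟨a, fun x₀ => contMDiffAt_section_of_coordinates fun L => ?_⟩, ?_⟩
  · obtain ⟨η, hη⟩ := exists_dualSection (E := E) (V := V) x₀ L
    refine ((d η).contMDiff x₀).congr_of_eventuallyEq ?_
    filter_upwards [hη] with x hx
    rw [← hx, ← ha]
  · ext ξ x
    exact (ha x ξ).symm

end DualSections

/-! ### Hadamard's lemma. -/

section Hadamard

open MeasureTheory Convolution Filter Topology

variable {E : Type*} [NormedAddCommGroup E] [NormedSpace ℝ E]

/-- The integral is a convolution with the indicator of (0, 1], evaluated at 0, of a kernel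
depending on the parameter `y`. The bump `χ` gives the kernel compact support in `t` and equals 1 on
the range of integration; the sign in `(-t) • y` undoes the reflection in the convolution. -/
theorem contDiff_integral_smul {G : Type*} [NormedAddCommGroup G] [NormedSpace ℝ G]
    [CompleteSpace G] {f : E → G} (hf : ContDiff ℝ ∞ f) :
    ContDiff ℝ ∞ fun y : E => ∫ t in (0 : ℝ)..1, f (t • y) := by
  let χ : ContDiffBump (0 : ℝ) := ⟨1, 2, one_pos, one_lt_two⟩
  let g : E → ℝ → G := fun y t => χ t • f ((-t) • y)
  let w : ℝ → ℝ := Set.indicator (Set.Ioc 0 1) 1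
  have hw : LocallyIntegrable w volume :=
    ((integrableOn_const (by simp) (by simp)).integrable_indicator measurableSet_Ioc).locallyIntegrable
  have h := contDiffOn_convolution_right_with_param_comp (𝕜 := ℝ) (μ := volume) (n := ⊤)
    (ContinuousLinearMap.lsmul ℝ ℝ : ℝ →L[ℝ] G →L[ℝ] G) (s := Set.univ) (v := fun _ : E => (0 : ℝ))
    contDiffOn_const (f := w) (g := g) (k := Metric.closedBall 0 2) isOpen_univ
    (isCompact_closedBall _ _) (fun y t _ ht => by
      have : χ t = 0 := χ.zero_of_le_dist (by
        simp only [Metric.mem_closedBall, not_le] at ht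
        exact ht.le)
      simp [g, this]) hw (by
      apply ContDiff.contDiffOn
      have h1 : ContDiff ℝ ∞ fun p : E × ℝ => χ p.2 := χ.contDiff.comp contDiff_snd
      exact h1.smul (hf.comp ((contDiff_snd.neg).smul contDiff_fst)))
  rw [contDiffOn_univ] at h
  have heq : (fun y : E => ∫ t in (0 : ℝ)..1, f (t • y)) =
      fun y => (w ⋆[ContinuousLinearMap.lsmul ℝ ℝ, volume] g y) 0 := funext fun y => ?_
  · rw [heq]
    exact h
  rw [convolution_def, intervalIntegral.integral_of_le zero_le_one,
    ← integral_indicator measurableSet_Ioc]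
  congr 1
  ext t
  by_cases ht : t ∈ Set.Ioc (0 : ℝ) 1
  · have : χ (-t) = 1 := χ.one_of_mem_closedBall (by
      simp only [Metric.mem_closedBall, dist_zero_right, norm_neg, Real.norm_eq_abs,
        abs_of_pos ht.1]
      exact ht.2)
    simp [w, g, ht, this]
  · simp [w, ht]

/-- Hadamard's lemma. -/
theorem exists_hadamard {f : E → ℝ} (hf : ContDiff ℝ ∞ f) (a : E) :
    ∃ H : E → (E →L[ℝ] ℝ), ContDiff ℝ ∞ H ∧ H a = fderiv ℝ f a ∧
      ∀ y, f y = f a + H y (y - a) := by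
  have hd : ContDiff ℝ ∞ fun z => fderiv ℝ f (a + z) :=
    (hf.fderiv_right (m := ∞) (by simp)).comp (contDiff_const.add contDiff_id)
  -- The witness is the mean of the derivative along the segment from `a` to `y`.
  refine ⟨fun y => ∫ t in (0 : ℝ)..1, fderiv ℝ f (a + t • (y - a)),
    (contDiff_integral_smul hd).comp (contDiff_id.sub contDiff_const), by simp, fun y => ?_⟩
  have hline : ∀ t : ℝ, HasDerivAt (fun t : ℝ => f (a + t • (y - a)))
      (fderiv ℝ f (a + t • (y - a)) (y - a)) t := fun t => by
    have h1 : HasDerivAt (fun t : ℝ => a + t • (y - a)) (y - a) t := by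
      simpa using ((hasDerivAt_id t).smul_const (y - a)).const_add a
    exact ((hf.differentiable (by simp)) _).hasFDerivAt.comp_hasDerivAt t h1
  have hcont : Continuous fun t : ℝ => fderiv ℝ f (a + t • (y - a)) :=
    hd.continuous.comp (continuous_id.smul continuous_const)
  have hftc := intervalIntegral.integral_eq_sub_of_hasDerivAt (fun t _ => hline t)
    ((hcont.clm_apply continuous_const).intervalIntegrable 0 1)
  rw [ContinuousLinearMap.intervalIntegral_apply (hcont.intervalIntegrable 0 1), hftc]
  simp

end Hadamard

/-! ### Dual bundles in a trivialization and maps from the dual space. -/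

section DualTrivialization

variable {M : Type*} [TopologicalSpace M]
  {F : Type*} [NormedAddCommGroup F] [NormedSpace ℝ F]
  {V : M → Type*} [TopologicalSpace (Bundle.TotalSpace F V)]
  [∀ x, AddCommGroup (V x)] [∀ x, Module ℝ (V x)] [∀ x, TopologicalSpace (V x)]
  [FiberBundle F V] [VectorBundle ℝ F V]

/-- The dual trivialization is precomposition with the inverse of the given one, so its inverse is
precomposition with the trivialization itself. -/
theorem dual_trivializationAt_symmL {x₀ y : M} (hy : y ∈ (trivializationAt F V x₀).baseSet)
    (L : F →L[ℝ] ℝ) :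
    (trivializationAt (F →L[ℝ] ℝ) (fun x => V x →L[ℝ] ℝ) x₀).symmL ℝ y L =
      L.comp ((trivializationAt F V x₀).continuousLinearMapAt ℝ y) := by
  let e := trivializationAt F V x₀
  let e' := trivializationAt (F →L[ℝ] ℝ) (fun x => V x →L[ℝ] ℝ) x₀
  have hy' : y ∈ e'.baseSet := by
    rw [hom_trivializationAt_baseSet]
    exact ⟨hy, Set.mem_univ _⟩
  have h : (e' ⟨y, L.comp (e.continuousLinearMapAt ℝ y)⟩).2 = L := by
    rw [hom_trivializationAt_apply]
    ext v
    have h1 : e.continuousLinearMapAt ℝ y (e.symmL ℝ y v) = v := e.continuousLinearMapAt_symmL hy v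
    refine Eq.trans ?_ (congrArg L h1)
    simp only [ContinuousLinearMap.inCoordinates, ContinuousLinearMap.comp_apply]
    exact congrArg (fun T : ℝ →L[ℝ] ℝ => T _)
      (Bundle.Trivial.continuousLinearMapAt_trivialization ℝ M ℝ y)
  conv_lhs => rw [← h]
  exact (e'.symmL_apply hy' _).trans (e'.symm_apply_apply_mk hy' _)

end DualTrivialization

section Bidual

open Filter

variable {E : Type*} [NormedAddCommGroup E] [NormedSpace ℝ E]
  {M : Type*} [TopologicalSpace M] [ChartedSpace E M]

/-- In a basis, `T` is a finite combination of constant rank-one maps whose coefficients are matrix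
entries, smooth by hypothesis. -/
theorem contMDiffAt_bidual {F : Type*} [NormedAddCommGroup F] [NormedSpace ℝ F]
    [FiniteDimensional ℝ F] {T : M → (F →L[ℝ] ℝ) →L[ℝ] F} {x₀ : M}
    (hT : ∀ α β : F →L[ℝ] ℝ, ContMDiffAt 𝓘(ℝ, E) 𝓘(ℝ, ℝ) ∞ (fun x => β (T x α)) x₀) :
    ContMDiffAt 𝓘(ℝ, E) 𝓘(ℝ, (F →L[ℝ] ℝ) →L[ℝ] F) ∞ T x₀ := by
  let b := Module.finBasis ℝ F
  let c := fun i => (b.coord i).toContinuousLinearMap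
  have h : ∀ x, T x = ∑ i, ∑ j, c j (T x (c i)) •
      (ContinuousLinearMap.apply ℝ ℝ (b i)).smulRight (b j) := fun x => by
    ext α
    have hα : α = ∑ i, α (b i) • c i := by
      ext v
      conv_lhs => rw [← b.sum_repr v, map_sum]
      rw [_root_.sum_apply]
      refine Finset.sum_congr rfl fun i _ => ?_
      rw [map_smul, smul_eq_mul, mul_comm]
      rfl
    conv_lhs => rw [hα, map_sum]
    rw [_root_.sum_apply]
    refine Finset.sum_congr rfl fun i _ => ?_
    rw [_root_.sum_apply, map_smul]
    conv_lhs => rw [← b.sum_repr (T x (c i)), Finset.smul_sum]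
    exact Finset.sum_congr rfl fun j _ => smul_comm _ _ _
  refine ContMDiffAt.congr_of_eventuallyEq ?_ (Eventually.of_forall h)
  exact ContMDiffAt.sum fun i _ => ContMDiffAt.sum fun j _ => (hT _ _).smul contMDiffAt_const

end Bidual

/-! ### Derivations as vector fields, skew biderivations as bivector fields. -/

section VectorFields

open Filter Topology

variable {E : Type*} [NormedAddCommGroup E] [NormedSpace ℝ E] [FiniteDimensional ℝ E]
  {M : Type*} [TopologicalSpace M] [ChartedSpace E M] [IsManifold 𝓘(ℝ, E) ∞ M]

/-- The differential of a smooth function, in the coordinates of the preferred chart. -/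
noncomputable def differential (f : C^∞⟮𝓘(ℝ, E), M; ℝ⟯) (x : M) : E →L[ℝ] ℝ :=
  mfderiv 𝓘(ℝ, E) 𝓘(ℝ, ℝ) f x

/-- Hadamard's lemma is stated on all of `E`, so the chart expression of `f` is cut off inside the
target of the chart. -/
theorem exists_smooth_germ (f : C^∞⟮𝓘(ℝ, E), M; ℝ⟯) (x₀ : M) :
    ∃ g : E → ℝ, ContDiff ℝ ∞ g ∧ (∀ᶠ x in 𝓝 x₀, f x = g (extChartAt 𝓘(ℝ, E) x₀ x)) ∧
      fderiv ℝ g (extChartAt 𝓘(ℝ, E) x₀ x₀) = differential f x₀ := by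
  let e := extChartAt 𝓘(ℝ, E) x₀
  obtain ⟨r, hr, hre⟩ := (Metric.nhds_basis_closedBall.mem_iff).mp
    (extChartAt_target_mem_nhds (I := 𝓘(ℝ, E)) x₀)
  let β : ContDiffBump (e x₀) := ⟨r / 2, r, by positivity, by linarith⟩
  have hβ : tsupport β ⊆ e.target := β.tsupport_eq.trans_subset hre
  have hloc : ∀ᶠ y in 𝓝 (e x₀), β y * f (e.symm y) = f (e.symm y) := by
    filter_upwards [β.eventuallyEq_one] with y hy
    rw [hy, Pi.one_apply, one_mul]
  refine ⟨fun y => β y * f (e.symm y), ?_, ?_, ?_⟩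
  · rw [← contMDiff_iff_contDiff]
    refine contMDiff_of_tsupport fun y hy => ?_
    have hye : y ∈ e.target := hβ (closure_mono (Function.support_mul_subset_left _ _) hy)
    refine (β.contDiff.contMDiff y).mul ((f.contMDiff _).comp y ?_)
    exact (contMDiffOn_extChartAt_symm x₀).contMDiffAt
      ((isOpen_extChartAt_target x₀).mem_nhds hye)
  · filter_upwards [(continuousAt_extChartAt x₀).eventually hloc,
      extChartAt_source_mem_nhds (I := 𝓘(ℝ, E)) x₀] with x hx hxe
    rw [hx, e.left_inv hxe]
  · rw [Filter.EventuallyEq.fderiv_eq hloc]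
    have hm := (f.contMDiff.mdifferentiableAt (x := x₀) (by simp)).mfderiv
    simp only [modelWithCornersSelf_coe, Set.range_id, fderivWithin_univ] at hm
    exact hm.symm

variable [T2Space M]

/-- The second property, at all points near `x₀`, turns values of a derivation on `u` into
coordinates of a vector field in one trivialization; this is what smoothness requires. -/
theorem exists_coordinate_function (x₀ : M) (L : E →L[ℝ] ℝ) :
    ∃ u : C^∞⟮𝓘(ℝ, E), M; ℝ⟯,
      (∀ᶠ x in 𝓝 x₀, u x = L (extChartAt 𝓘(ℝ, E) x₀ x)) ∧
      ∀ᶠ x in 𝓝 x₀, ∀ v : E, differential u x v =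
        L (trivializationAt E (TangentSpace 𝓘(ℝ, E)) x₀ ⟨x, v⟩).2 := by
  obtain ⟨u, hu⟩ := exists_smooth_extension (E := E) (chartAt E x₀).open_source
    (mem_chart_source E x₀) (f := fun x => L (extChartAt 𝓘(ℝ, E) x₀ x))
    (L.contDiff.contMDiff.comp_contMDiffOn contMDiffOn_extChartAt)
  refine ⟨u, hu, ?_⟩
  filter_upwards [hu.eventually_nhds, (chartAt E x₀).open_source.mem_nhds
    (mem_chart_source E x₀)] with x hx hxs v
  rw [differential, Filter.EventuallyEq.mfderiv_eq hx]
  have hc := (L.hasMFDerivAt.comp x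
    (mdifferentiableAt_extChartAt (I := 𝓘(ℝ, E)) hxs).hasMFDerivAt).mfderiv
  refine (congrArg (fun T : E →L[ℝ] ℝ => T v) hc).trans (congrArg L ?_)
  exact (congrArg (fun T : E →L[ℝ] E => T v)
    (TangentBundle.continuousLinearMapAt_trivializationAt hxs).symm).trans
    (congrFun ((trivializationAt E (TangentSpace 𝓘(ℝ, E)) x₀).coe_linearMapAt_of_mem hxs) v)

theorem derivation_apply_eq (Z : Derivation ℝ C^∞⟮𝓘(ℝ, E), M; ℝ⟯ C^∞⟮𝓘(ℝ, E), M; ℝ⟯) {x : M}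
    {f g : C^∞⟮𝓘(ℝ, E), M; ℝ⟯} (h : ∀ᶠ y in 𝓝 x, f y = g y) : Z f x = Z g x := by
  obtain ⟨ρ, hρ, h1⟩ := exists_smooth_bump (E := E) h
  have h0 : ρ * (f - g) = 0 := by
    ext y
    change ρ y * (f y - g y) = 0
    by_cases hy : y ∈ tsupport ρ
    · have hfg : f y = g y := hρ hy
      rw [hfg, sub_self, mul_zero]
    · rw [image_eq_zero_of_notMem_tsupport hy, zero_mul]
  have h2 : ρ x * (Z f x - Z g x) + (f x - g x) * Z ρ x = 0 := by
    have : Z (ρ * (f - g)) x = 0 := by rw [h0, map_zero]; rfl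
    rw [Derivation.leibniz, map_sub] at this
    exact this
  rw [h.self_of_nhds, sub_self, zero_mul, add_zero, h1.self_of_nhds, one_mul] at h2
  exact sub_eq_zero.mp h2

/-- A derivation of the algebra of smooth functions in the coordinates of a chart. -/
theorem exists_coordinates_derivation (x : M) :
    ∃ u : Fin (Module.finrank ℝ E) → C^∞⟮𝓘(ℝ, E), M; ℝ⟯,
      ∀ (Z : Derivation ℝ C^∞⟮𝓘(ℝ, E), M; ℝ⟯ C^∞⟮𝓘(ℝ, E), M; ℝ⟯) (f : C^∞⟮𝓘(ℝ, E), M; ℝ⟯),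
        Z f x = ∑ i, differential f x (Module.finBasis ℝ E i) * Z (u i) x := by
  let b := Module.finBasis ℝ E
  choose u hu _ using fun i => exists_coordinate_function x (b.coord i).toContinuousLinearMap
  refine ⟨u, fun Z f => ?_⟩
  obtain ⟨g, hg, hfg, hdg⟩ := exists_smooth_germ f x
  obtain ⟨H, hH, hHa, hHy⟩ := exists_hadamard hg (extChartAt 𝓘(ℝ, E) x x)
  choose h hh using fun i => exists_smooth_extension (E := E) (chartAt E x).open_source
    (mem_chart_source E x) (f := fun y => H (extChartAt 𝓘(ℝ, E) x y) (b i))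
    ((hH.clm_apply contDiff_const).contMDiff.comp_contMDiffOn contMDiffOn_extChartAt)
  -- By Hadamard, near `x` the function is f(x) + Σ (uᵢ - uᵢ(x)) hᵢ; at `x` the Leibniz rule leaves
  -- Σ hᵢ(x) Z(uᵢ)(x).
  have key : Z f x = Z (algebraMap ℝ _ (f x) + ∑ i, (u i - algebraMap ℝ _ (u i x)) * h i) x := by
    refine derivation_apply_eq Z ?_
    filter_upwards [hfg, eventually_all.mpr hu, eventually_all.mpr hh] with y hy huy hhy
    change f y = f x + (∑ i, (u i - algebraMap ℝ _ (u i x)) * h i : C^∞⟮𝓘(ℝ, E), M; ℝ⟯) y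
    rw [function_sum_apply, hy, hHy, hfg.self_of_nhds]
    congr 1
    have hexp : extChartAt 𝓘(ℝ, E) x y - extChartAt 𝓘(ℝ, E) x x =
        ∑ i, (u i y - u i x) • b i := by
      refine (b.sum_repr _).symm.trans (Finset.sum_congr rfl fun i _ => ?_)
      rw [huy, (hu i).self_of_nhds, ← map_sub]
      rfl
    rw [hexp, map_sum]
    refine Finset.sum_congr rfl fun i _ => ?_
    rw [map_smul, ← hhy]
    rfl
  rw [key, map_add, Derivation.map_algebraMap, zero_add, map_sum, function_sum_apply]
  refine Finset.sum_congr rfl fun i _ => ?_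
  rw [Derivation.leibniz, map_sub, Derivation.map_algebraMap, sub_zero]
  change (u i x - u i x) * _ + h i x * Z (u i) x = _
  rw [sub_self, zero_mul, zero_add, (hh i).self_of_nhds, hHa, hdg]

theorem exists_isVectorField_derivation
    (Z : Derivation ℝ C^∞⟮𝓘(ℝ, E), M; ℝ⟯ C^∞⟮𝓘(ℝ, E), M; ℝ⟯) :
    ∃ v : Cₛ^∞⟮𝓘(ℝ, E); E, fun x : M => TangentSpace 𝓘(ℝ, E) x⟯,
      ∀ (f : C^∞⟮𝓘(ℝ, E), M; ℝ⟯) (x : M), Z f x = differential f x (v x) := by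
  have hpt : ∀ x : M, ∃ v : E, ∀ f : C^∞⟮𝓘(ℝ, E), M; ℝ⟯, Z f x = differential f x v := fun x => by
    obtain ⟨u, hu⟩ := exists_coordinates_derivation (E := E) x
    refine ⟨∑ i, Z (u i) x • Module.finBasis ℝ E i, fun f => ?_⟩
    rw [hu, map_sum]
    refine Finset.sum_congr rfl fun i _ => ?_
    rw [map_smul, smul_eq_mul, mul_comm]
  choose v hv using hpt
  refine ⟨⟨v, fun x₀ => contMDiffAt_section_of_coordinates fun L => ?_⟩, fun f x => hv x f⟩
  -- Near `x₀` the `L`-coordinate of `v` is the smooth function `Z u`.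
  obtain ⟨u, -, hu⟩ := exists_coordinate_function (E := E) x₀ L
  refine ((Z u).contMDiff x₀).congr_of_eventuallyEq ?_
  filter_upwards [hu] with x hx
  rw [← hx, ← hv]

theorem isVectorField_derivation
    (Z : Derivation ℝ C^∞⟮𝓘(ℝ, E), M; ℝ⟯ C^∞⟮𝓘(ℝ, E), M; ℝ⟯) : IsVectorField Z :=
  exists_isVectorField_derivation Z

theorem isBivectorField_biderivation
    (P : C^∞⟮𝓘(ℝ, E), M; ℝ⟯ → Derivation ℝ C^∞⟮𝓘(ℝ, E), M; ℝ⟯ C^∞⟮𝓘(ℝ, E), M; ℝ⟯)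
    (hP : ∀ f g, P f g = -P g f) : IsBivectorField fun f g => P f g := by
  choose v hv using fun f => exists_isVectorField_derivation (P f)
  have hpt : ∀ x : M, ∃ s : (E →L[ℝ] ℝ) →L[ℝ] E,
      ∀ f g : C^∞⟮𝓘(ℝ, E), M; ℝ⟯, P f g x = differential g x (s (differential f x)) := fun x => by
    obtain ⟨u, hu⟩ := exists_coordinates_derivation (E := E) x
    -- Skewness allows expanding in the first argument: the bundle map sends df to Σ df(bᵢ) v(uᵢ).
    let w : Fin (Module.finrank ℝ E) → E := fun i => v (u i) x
    refine ⟨∑ i, (ContinuousLinearMap.apply ℝ ℝ (Module.finBasis ℝ E i)).smulRight (w i),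
      fun f g => ?_⟩
    rw [hP]
    change -(P g f x) = _
    rw [hu, _root_.sum_apply, map_sum, ← Finset.sum_neg_distrib]
    refine Finset.sum_congr rfl fun i _ => ?_
    have hw : differential g x (w i) = -(P g (u i) x) :=
      (hv _ _ _).symm.trans (congrArg (fun h : C^∞⟮𝓘(ℝ, E), M; ℝ⟯ => h x) (hP (u i) g))
    rw [ContinuousLinearMap.smulRight_apply, map_smul, hw, smul_eq_mul, ← mul_neg]
    rfl
  choose s hs using hpt
  refine ⟨⟨s, fun x₀ => ?_⟩, fun x α => ?_, fun f g x => hs x f g⟩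
  · let s' : ∀ x : M, (TangentSpace 𝓘(ℝ, E) x →L[ℝ] ℝ) →L[ℝ] TangentSpace 𝓘(ℝ, E) x := s
    change ContMDiffAt _ _ _ (fun x => Bundle.TotalSpace.mk' ((E →L[ℝ] ℝ) →L[ℝ] E) x (s' x)) x₀
    rw [Bundle.contMDiffAt_section]
    refine contMDiffAt_bidual fun α β => ?_
    obtain ⟨f, -, hf⟩ := exists_coordinate_function (E := E) x₀ α
    obtain ⟨g, -, hg⟩ := exists_coordinate_function (E := E) x₀ β
    refine ((P f g).contMDiff x₀).congr_of_eventuallyEq ?_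
    filter_upwards [hf, hg, (trivializationAt E (TangentSpace 𝓘(ℝ, E)) x₀).open_baseSet.mem_nhds
      (FiberBundle.mem_baseSet_trivializationAt' x₀)] with x hfx hgx hx
    rw [hs, hgx, hom_trivializationAt_apply]
    have hα : differential f x =
        (trivializationAt (E →L[ℝ] ℝ) (fun x => TangentSpace 𝓘(ℝ, E) x →L[ℝ] ℝ) x₀).symmL ℝ x α := by
      refine Eq.trans ?_ (dual_trivializationAt_symmL hx α).symm
      ext w
      exact (hfx w).trans (congrArg α (congrFun
        ((trivializationAt E (TangentSpace 𝓘(ℝ, E)) x₀).coe_linearMapAt_of_mem hx) w).symm)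
    rw [hα]
    exact congrArg β (congrFun
      ((trivializationAt E (TangentSpace 𝓘(ℝ, E)) x₀).coe_linearMapAt_of_mem hx) _)
  -- Every covector at `x` is the differential of a function, so skewness on fibres follows from
  -- P(f, f) = 0.
  · obtain ⟨f, -, hf⟩ := exists_coordinate_function (E := E) x
      ((show E →L[ℝ] ℝ from α).comp ((trivializationAt E (TangentSpace 𝓘(ℝ, E)) x).symmL ℝ x))
    have hfα : differential f x = α := by
      ext w
      rw [hf.self_of_nhds]
      have hx := FiberBundle.mem_baseSet_trivializationAt' (F := E)
        (E := (TangentSpace 𝓘(ℝ, E) : M → Type _)) x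
      let e := trivializationAt E (TangentSpace 𝓘(ℝ, E) : M → Type _) x
      exact congrArg α ((e.symmL_apply hx _).trans (e.symm_apply_apply_mk hx w))
    have h0 : P f f x = 0 := by
      have h1 : P f f x = -(P f f x) := congrArg (fun h : C^∞⟮𝓘(ℝ, E), M; ℝ⟯ => h x) (hP f f)
      linarith
    rw [hs, hfα] at h0
    exact h0

end VectorFields

/-! ### Preparation of the hypotheses. -/

section JacobiBialgebroid

variable {C N : Type*} [CommRing C] [Algebra ℝ C] [AddCommGroup N] [Module C N] [Module ℝ N]
  [IsScalarTower ℝ C N] {μ : SuperFunctions C N} {φ : N}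

/-- {φ, φ} = 0, and {μ, μ} and 2{μ, φ} have different orders, 1 and 0, so their sum vanishes only if
both do. -/
theorem bb_add_ofCovector_self_eq_zero (hμ : μ ∈ symbolsOfWeight C N 1 1)
    (h : bb (μ + ofCovector φ) (μ + ofCovector φ) = 0) :
    bb μ μ = 0 ∧ bb μ (ofCovector φ) = 0 := by
  have hφ := ofCovector_mem (C := C) φ
  have hsymm : bb (ofCovector φ) μ = bb μ (ofCovector φ) :=
    (isOdd_ofCovector φ).bb_symm (isOdd_of_mem hμ (by decide))
  have hμμ : bb μ μ ∈ symbolsOfWeight C N 1 2 := bb_mem_symbolsOfWeight hμ hμ rfl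
  have hμφ : bb μ (ofCovector φ) ∈ symbolsOfWeight C N 0 2 := bb_mem_symbolsOfWeight hμ hφ rfl
  rw [bb_add_left, bb_add_right, bb_add_right, bb_eq_zero_of_symbolsOfWeight_zero hφ hφ, hsymm,
    add_zero, add_assoc] at h
  obtain ⟨h1, h2⟩ := eq_zero_of_add_eq_zero hμμ (add_mem_symbolsOfWeight hμφ hμφ) one_ne_zero h
  exact ⟨h1, smul_two_eq_zero h2⟩

theorem preJacobiBracket_zero_right (P : SuperFunctions C N) : preJacobiBracket μ φ P 0 = 0 := by
  simp only [preJacobiBracket, bb_zero_right, mul_zero, sub_zero, add_zero]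

theorem preJacobiDifferential_zero (ν : SuperFunctions C N) (X : Module.Dual C N) :
    preJacobiDifferential ν X 0 = 0 := by
  simp only [preJacobiDifferential, bb_zero_right, mul_zero, add_zero]

end JacobiBialgebroid

section Multisections

variable {E : Type*} [NormedAddCommGroup E] [NormedSpace ℝ E] {M : Type*} [TopologicalSpace M]
  [ChartedSpace E M] {F : Type*} [NormedAddCommGroup F] [NormedSpace ℝ F] {V : M → Type*}
  [TopologicalSpace (Bundle.TotalSpace F V)] [∀ x, AddCommGroup (V x)] [∀ x, Module ℝ (V x)]
  [∀ x, TopologicalSpace (V x)] [FiberBundle F V] [VectorBundle ℝ F V]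

theorem ofFun_mem_multisection (f : C^∞⟮𝓘(ℝ, E), M; ℝ⟯) : ofFun f ∈ multisection E F V 0 :=
  Submodule.subset_span ⟨f, Fin.elim0, by simp⟩

theorem ofSection_mem_multisection (a : Cₛ^∞⟮𝓘(ℝ, E); F, V⟯) :
    ofSection a ∈ multisection E F V 1 :=
  Submodule.subset_span ⟨1, fun _ => a, by simp [ofFun_one]⟩

end Multisections

end BigBracket


/-! ### The theorem for vector bundles. -/

theorem mainTheorem5
    {E : Type*} [NormedAddCommGroup E] [NormedSpace ℝ E] [FiniteDimensional ℝ E]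
    {M : Type*} [TopologicalSpace M] [ChartedSpace E M] [IsManifold 𝓘(ℝ, E) ∞ M]
    [T2Space M] [SigmaCompactSpace M]
    {F : Type*} [NormedAddCommGroup F] [NormedSpace ℝ F] [FiniteDimensional ℝ F]
    {V : M → Type*} [TopologicalSpace (Bundle.TotalSpace F V)]
    [∀ x, AddCommGroup (V x)] [∀ x, Module ℝ (V x)] [∀ x, TopologicalSpace (V x)]
    [∀ x, IsTopologicalAddGroup (V x)] [∀ x, ContinuousSMul ℝ (V x)]
    [FiberBundle F V] [VectorBundle ℝ F V] [ContMDiffVectorBundle ∞ F V 𝓘(ℝ, E)]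
    (μ ν : BigBracket.FunctionAlgebra E F V)
    (φ : BigBracket.DualSection E F V) (X : Cₛ^∞⟮𝓘(ℝ, E); F, V⟯)
    (h : BigBracket.IsJacobiBialgebroid μ φ ν X) :
    ∃ (Z : C^∞⟮𝓘(ℝ, E), M; ℝ⟯ → C^∞⟮𝓘(ℝ, E), M; ℝ⟯)
      (P : C^∞⟮𝓘(ℝ, E), M; ℝ⟯ → C^∞⟮𝓘(ℝ, E), M; ℝ⟯ → C^∞⟮𝓘(ℝ, E), M; ℝ⟯),
      (BigBracket.IsVectorField Z ∧
        (∀ f, BigBracket.bb (BigBracket.bb μ (BigBracket.ofSection X)) (BigBracket.ofFun f) =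
          BigBracket.ofFun (Z f)) ∧
        (∀ f, -BigBracket.bb (BigBracket.bb ν (BigBracket.ofCovector φ)) (BigBracket.ofFun f) =
          BigBracket.ofFun (Z f))) ∧
      (BigBracket.IsBivectorField P ∧
        ∀ f g, BigBracket.bb (BigBracket.bb μ (BigBracket.ofFun f))
            (BigBracket.bb ν (BigBracket.ofFun g)) = BigBracket.ofFun (P f g)) ∧
      BigBracket.IsJacobiStructure P (-Z) := by
  open BigBracket in
  -- Bidegrees (1, 2) and (2, 1) are orders 1 and 2 with weights 1 and -1.
  have hμ : μ ∈ symbolsOfWeight C^∞⟮𝓘(ℝ, E), M; ℝ⟯ (DualSection E F V) 1 1 := h.bidegree_left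
  have hν : ν ∈ symbolsOfWeight C^∞⟮𝓘(ℝ, E), M; ℝ⟯ (DualSection E F V) 2 (-1) := h.bidegree_right
  obtain ⟨hμμ, hμφ⟩ := bb_add_ofCovector_self_eq_zero hμ h.jacobi_left
  have hfun : ∀ f : C^∞⟮𝓘(ℝ, E), M; ℝ⟯, ofFun f ∈ ⨆ l, multisection E F V l := fun f =>
    Submodule.mem_iSup_of_mem 0 (ofFun_mem_multisection f)
  -- To serve as b in the compatibility condition, df must be a genuine section of A, not just a
  -- linear form on sections of A*.
  have hdiff : ∀ f : C^∞⟮𝓘(ℝ, E), M; ℝ⟯,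
      preJacobiDifferential ν (pairing X) (ofFun f) ∈ ⨆ l, multisection E F V l := fun f => by
    obtain ⟨d, hd⟩ := exists_eq_ofVector (preJacobiDifferential_fun_mem (X := pairing X) hν f)
    obtain ⟨a, rfl⟩ := pairing_surjective d
    rw [hd]
    exact Submodule.mem_iSup_of_mem 1 (ofSection_mem_multisection a)
  have hc : ∀ f : C^∞⟮𝓘(ℝ, E), M; ℝ⟯, ∀ b ∈ ⨆ l, multisection E F V l,
      preJacobiDifferential ν (pairing X) (preJacobiBracket μ φ (ofFun f) b) =
        preJacobiBracket μ φ (preJacobiDifferential ν (pairing X) (ofFun f)) b -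
          preJacobiBracket μ φ (ofFun f) (preJacobiDifferential ν (pairing X) b) := fun f b hb => by
    have h1 := h.compatible 0 (ofFun f) (ofFun_mem_multisection f) b hb
    rwa [zero_add, pow_one, neg_one_smul, ← sub_eq_add_neg] at h1
  obtain ⟨Z, P, hZ, hZ', hP, hskew, hZP, hPP⟩ := exists_derivation_biderivation (X := pairing X)
    hμ hν hμμ hμφ
    (fun f g => by
      have h1 := hc f (ofFun g) (hfun g)
      rw [preJacobiBracket_fun_fun hμ, preJacobiDifferential_zero] at h1
      exact sub_eq_zero.mp h1.symm)
    (fun f g => by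
      have h2 : preJacobiDifferential ν (pairing X)
          (preJacobiDifferential ν (pairing X) (ofFun g)) = 0 := h.differential_sq _ (hfun g)
      rw [hc f _ (hdiff g), h2, preJacobiBracket_zero_right, sub_zero])
  refine ⟨Z, fun f g => P f g, ⟨isVectorField_derivation Z, hZ, hZ'⟩,
    ⟨isBivectorField_biderivation P hskew, hP⟩, isBivectorField_biderivation P hskew,
    isVectorField_derivation (-Z), fun f g k => ?_, fun f g => ?_⟩
  · simp only [schoutenBivector, wedgeVectorBivector, Pi.neg_apply]
    linear_combination 2 * hPP f g k
  · simp only [schoutenVectorBivector, Pi.neg_apply]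
    -- `P` is bundled as a derivation in its second argument only, so a sign in the first is moved
    -- by skewness.
    have hneg : P (-(Z f)) g = -P (Z f) g := by
      rw [hskew, map_neg, hskew g, neg_neg]
    rw [hneg, map_neg, hZP]
    ring
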